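/- Let $R\subset\mathbb{R}^N\setminus\{0\}$ be a root system, i.e. a finite set with $R\cap\mathbb{R}\alpha=\{\alpha,-\alpha\}$ and $\sigma_\alpha(R)=R$ for all $\alpha\in R$, where $\sigma_\alpha x=x-2\frac{\langle\alpha,x\rangle}{\langle\alpha,\alpha\rangle}\alpha$; assume it normalised by $|\alpha|^2=2$ for all $\alpha\in R$. Let $G$ be the finite group generated by the reflections $\sigma_\alpha$, $\alpha \in R$, let $R_+$ be a positive subsystem (the roots on one side of a hyperplane through $0$ that contains no root), let $k:R\to[0,\infty)$ be $G$-invariant, and put $\gamma=\sum_{\alpha\in R_+}k_\alpha$. The Dunkl operators are $$T_if(x)=\partial_if(x)+\sum_{\alpha\in R_+}k_\alpha\alpha_i\frac{f(x)-f(\sigma_\alpha x)}{\langle\alpha,x\rangle},\qquad 1\le i\le N,$$ where for $\langle\alpha,x\rangle=0$ the quotient means its limit $\langle\alpha,\nabla f(x)\rangle$. Put $\nabla_k=(T_1,\dots,T_N)$ and $\Delta_k=\sum_iT_i^2$. Let $b=(b_1,\dots,b_N)$ with $b_i\in C^1(\mathbb{R}^N)$, let $L=\Delta_k+b\cdot\nabla_k$,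 and let $\tilde\Gamma(f)(x)=\sum_{g\in G}|\nabla_kf(gx)|^2$. Let $(P_t)_{t\ge0}$ be a Markov semigroup on $C_b(\mathbb{R}^N)$ (a semigroup of positivity preserving linear operators with $P_0=\mathrm{id}$ and $P_t1=1$) generated by $L$, in the sense that $\frac1t(P_tf-f)\to Lf$ uniformly as $t\to0^+$ for every $f\in C_c^\infty(\mathbb{R}^N)$. A Lyapunov function for $L$ is a function $\rho:\mathbb{R}^N\to[0,\infty]$ that is smooth (continuous into $[0,\infty]$ and $C^\infty$ on the open set $\{\rho<\infty\}$) and such that (i) $\{\rho<\infty\}\ne\emptyset$; (ii) $\{\rho\le M\}$ is compact for every $M>0$; (iii) there are constants $C_1\ge0$ and $C_2>0$ such that $L\rho(x)\le C_1-C_2\rho(x)$ for all $x$ with $\rho(x)<\infty$. (For $L\rho(x)$ to be defined at all such $x$, it is part of (iii) that $\rho(x)<\infty$ implies $\rho(\sigma_\alpha x)<\infty$ for all $\alpha\in R_+$ with $k_\alpha\neq0$.) **Theorem.** Let $\gamma<\frac12$. Assume that there is $\eta<0$ such that for all $f\in C_c^\infty(\mathbb{R}^N)$ and all $t>0$ the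 function $P_tf$ is $C^1$ and $$\tilde\Gamma(P_tf)\le e^{2\eta t}P_t(\tilde\Gamma(f))$$ pointwise on $\mathbb{R}^N$. Assume moreover that there is a Lyapunov function $\rho$ for $L$. Then there exist a sequence $t_l\to\infty$ and a probability measure $\nu$ on $\mathbb{R}^N$ such that for every bounded continuous $f$ and every $x\in\mathbb{R}^N$ with $\rho(x)<\infty$, $$P_{t_l}f(x)\to\int f\,d\nu\qquad\text{as } l\to\infty.$$ Moreover, $\nu$ is invariant for the semigroup: $\int P_tf\,d\nu=\int f\,d\nu$ for all $t\ge0$ and all bounded continuous $f$. -/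

import Mathlib

open Filter Topology MeasureTheory
open scoped NNReal ENNReal ContDiff BoundedContinuousFunction

noncomputable section

namespace Dunkl

/-- The Euclidean space `ℝ^N`. -/
abbrev E (N : ℕ) : Type := EuclideanSpace ℝ (Fin N)

/-- The orthogonal reflection `σ_α x = x - 2 ⟨α, x⟩ / ⟨α, α⟩ α` in the hyperplane orthogonal
to `α`. -/
def refl {N : ℕ} (α : E N) : E N ≃ₗᵢ[ℝ] E N :=
  ((Submodule.span ℝ {α})ᗮ).reflection

/-- The group generated by the reflections `σ_α`, `α ∈ R`. -/
def reflectionGroup {N : ℕ} (R : Finset (E N)) : Subgroup (E N ≃ₗᵢ[ℝ] E N) :=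
  Subgroup.closure {g | ∃ α ∈ R, g = refl α}

/-- A normalised root system `R` in `ℝ^N`, a positive subsystem `R₊` and a nonnegative
multiplicity function `k` (only its values on `R` matter). -/
structure RootData (N : ℕ) where
  /-- the root system -/
  R : Finset (E N)
  zero_notMem : (0 : E N) ∉ R
  /-- `R ∩ ℝα = {α, -α}` -/
  smul_mem_iff : ∀ α ∈ R, ∀ c : ℝ, c • α ∈ R ↔ c = 1 ∨ c = -1
  refl_mem : ∀ α ∈ R, ∀ β ∈ R, refl α β ∈ R
  norm_sq : ∀ α ∈ R, ‖α‖ ^ 2 = 2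
  /-- the positive subsystem: the roots on one side of a hyperplane which contains no root -/
  Rplus : Finset (E N)
  exists_hyperplane : ∃ v : E N, (∀ α ∈ R, inner ℝ v α ≠ 0) ∧
    ∀ α, α ∈ Rplus ↔ α ∈ R ∧ 0 < inner ℝ v α
  /-- the multiplicity function -/
  k : E N → ℝ
  k_nonneg : ∀ α ∈ R, 0 ≤ k α
  k_invariant : ∀ g ∈ reflectionGroup R, ∀ α ∈ R, k (g α) = k α

namespace RootData

variable {N : ℕ} (D : RootData N)

/-- The reflection group `G` of the root system. -/
abbrev G : Subgroup (E N ≃ₗᵢ[ℝ] E N) := reflectionGroup D.R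

theorem G_map_root {g : E N ≃ₗᵢ[ℝ] E N} (hg : g ∈ D.G) : ∀ β ∈ D.R, g β ∈ D.R := by
  induction hg using Subgroup.closure_induction with
  | mem x hx =>
    obtain ⟨α, hα, rfl⟩ := hx
    exact D.refl_mem α hα
  | one => intro β hβ; simpa using hβ
  | mul x y _ _ hx hy => intro β hβ; exact hx _ (hy _ hβ)
  | inv x _ hx =>
    intro β hβ
    have hinj : Set.InjOn x (D.R : Set (E N)) := x.injective.injOn
    obtain ⟨γ, hγ, rfl⟩ := Finset.surjOn_of_injOn_of_card_le x hx hinj le_rfl hβ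
    have : x⁻¹ (x γ) = γ := x.symm_apply_apply γ
    rw [this]; exact hγ

theorem G_fix {g : E N ≃ₗᵢ[ℝ] E N} (hg : g ∈ D.G) :
    ∀ x ∈ (Submodule.span ℝ (D.R : Set (E N)))ᗮ, g x = x := by
  induction hg using Subgroup.closure_induction with
  | mem y hy =>
    obtain ⟨α, hα, rfl⟩ := hy
    intro x hx
    refine Submodule.reflection_mem_subspace_eq_self ?_
    exact Submodule.orthogonal_le (Submodule.span_mono (by simpa using hα)) hx
  | one => intro x _; rfl
  | mul y z _ _ hy hz =>
    intro x hx
    change y (z x) = x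
    rw [hz x hx, hy x hx]
  | inv y _ hy =>
    intro x hx
    have : y⁻¹ (y x) = x := y.symm_apply_apply x
    rwa [hy x hx] at this

instance finite_G : Finite D.G := by
  let F : D.G → (D.R → D.R) := fun g r => ⟨g.1 r.1, D.G_map_root g.2 r.1 r.2⟩
  refine Finite.of_injective F fun g h hgh => ?_
  have hR : ∀ r ∈ D.R, g.1 r = h.1 r := fun r hr =>
    congrArg Subtype.val (congrFun hgh ⟨r, hr⟩)
  have hspan : ∀ x ∈ Submodule.span ℝ (D.R : Set (E N)), g.1 x = h.1 x := by
    intro x hx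
    induction hx using Submodule.span_induction with
    | mem x hx => exact hR x hx
    | zero => simp
    | add x y _ _ hx hy => simp [hx, hy]
    | smul c x _ hx => simp [hx]
  ext1
  ext1 x
  obtain ⟨y, hy, z, hz, rfl⟩ :=
    (Submodule.span ℝ (D.R : Set (E N))).exists_add_mem_mem_orthogonal x
  rw [map_add, map_add, hspan y hy, D.G_fix g.2 z hz, D.G_fix h.2 z hz]

instance fintype_G : Fintype D.G := Fintype.ofFinite _

/-- `γ = ∑_{α ∈ R₊} k_α`. -/
def gamma : ℝ := ∑ α ∈ D.Rplus, D.k α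

end RootData

variable {N : ℕ}

/-- The difference quotient `(f x - f (σ_α x)) / ⟨α, x⟩`, extended to the hyperplane
`⟨α, x⟩ = 0` by its limit, the directional derivative of `f` along `α` (here `|α|² = 2`). -/
def diffQuot (α : E N) (f : E N → ℝ) (x : E N) : ℝ :=
  open Classical in
  if inner ℝ α x = 0 then fderiv ℝ f x α else (f x - f (refl α x)) / inner ℝ α x

/-- The Dunkl operator `T_i`. -/
def T (D : RootData N) (i : Fin N) (f : E N → ℝ) (x : E N) : ℝ :=
  fderiv ℝ f x (EuclideanSpace.single i 1) + ∑ α ∈ D.Rplus, D.k α * α i * diffQuot α f x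

/-- The symmetrised gradient form `∑_{g ∈ G} |∇_k f (g x)|²`. -/
def symGrad (D : RootData N) (f : E N → ℝ) (x : E N) : ℝ :=
  ∑ g : D.G, ∑ i : Fin N, (T D i f (g.1 x)) ^ 2

/-- The operator `L = ∑ i, (T_i² + b_i T_i) = Δ_k + b · ∇_k`. -/
def L (D : RootData N) (b : E N → E N) (f : E N → ℝ) (x : E N) : ℝ :=
  ∑ i : Fin N, (T D i (T D i f) x + b x i * T D i f x)

/-- A smooth function with compact support, for `f` in `C_b(ℝ^N)`. -/
def IsTest (f : E N →ᵇ ℝ) : Prop :=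
  ContDiff ℝ ∞ (f : E N → ℝ) ∧ HasCompactSupport (f : E N → ℝ)

/-- A Markov semigroup on `C_b(ℝ^N)`: a semigroup of positivity preserving linear operators
which fix the constant function `1` (they are then contractions). -/
structure MarkovSemigroup (N : ℕ) where
  /-- the operators `P_t` -/
  P : ℝ≥0 → (E N →ᵇ ℝ) →ₗ[ℝ] (E N →ᵇ ℝ)
  zero : ∀ f, P 0 f = f
  add : ∀ s t f, P (s + t) f = P s (P t f)
  one : ∀ t, P t (BoundedContinuousFunction.const (E N) 1) =
    BoundedContinuousFunction.const (E N) 1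
  nonneg : ∀ t f, (∀ x, 0 ≤ f x) → ∀ x, 0 ≤ P t f x

/-- The generator of the semigroup is given by `L` on test functions:
`(P_t f - f) / t → L f` in supremum norm as `t → 0+`. -/
def MarkovSemigroup.IsGeneratedBy (S : MarkovSemigroup N) (D : RootData N) (b : E N → E N) :
    Prop :=
  ∀ f : E N →ᵇ ℝ, IsTest f →
    TendstoUniformly (fun (t : ℝ≥0) (x : E N) => (S.P t f x - f x) / (t : ℝ))
      (L D b f) (𝓝[>] 0)

/-- The gradient bound `Γ̃(P_t f) ≤ e^{2ηt} P_t(Γ̃ f)` for all `t > 0` and all test functions `f`;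
it includes that `P_t f` is `C¹`, so that the left side makes sense. The function `g` is
`Γ̃ f`, viewed as an element of `C_b(ℝ^N)`. -/
def MarkovSemigroup.GradientBound (S : MarkovSemigroup N) (D : RootData N) (η : ℝ) : Prop :=
  ∀ f : E N →ᵇ ℝ, IsTest f → ∀ g : E N →ᵇ ℝ, (∀ x, g x = symGrad D f x) →
    ∀ t : ℝ≥0, 0 < t → ContDiff ℝ 1 (S.P t f : E N → ℝ) ∧
      ∀ x, symGrad D (S.P t f) x ≤ Real.exp (2 * η * t) * S.P t g x

/-- A Lyapunov function `ρ : ℝ^N → [0, ∞]` for `L`. Smoothness means that `ρ` is continuous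
into `[0, ∞]` and `C^∞` on the open set where it is finite. The field `refl_ne_top` says that
`L ρ` is meaningful wherever `ρ` is finite: it involves the values of `ρ` at the points
`σ_α x` with `k_α ≠ 0`. -/
structure IsLyapunov (D : RootData N) (b : E N → E N) (ρ : E N → ℝ≥0∞) : Prop where
  continuous : Continuous ρ
  smooth : ContDiffOn ℝ ∞ (fun x => (ρ x).toReal) {x | ρ x ≠ ⊤}
  exists_ne_top : ∃ x, ρ x ≠ ⊤
  isCompact_le : ∀ M : ℝ≥0, 0 < M → IsCompact {x | ρ x ≤ (M : ℝ≥0∞)}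
  refl_ne_top : ∀ α ∈ D.Rplus, D.k α ≠ 0 → ∀ x, ρ x ≠ ⊤ → ρ (refl α x) ≠ ⊤
  drift : ∃ C₁ C₂ : ℝ, 0 ≤ C₁ ∧ 0 < C₂ ∧ ∀ x, ρ x ≠ ⊤ →
    L D b (fun y => (ρ y).toReal) x ≤ C₁ - C₂ * (ρ x).toReal

/-- `ν` is invariant for the semigroup: `∫ P_t f dν = ∫ f dν` for all `t` and `f ∈ C_b`. -/
def MarkovSemigroup.IsInvariant (S : MarkovSemigroup N) (ν : Measure (E N)) : Prop :=
  ∀ (t : ℝ≥0) (f : E N →ᵇ ℝ), ∫ x, S.P t f x ∂ν = ∫ x, f x ∂ν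

end Dunkl

end

/-!
A Lyapunov function only bounds `P_t` on functions that grow more slowly than `√(1 + ρ)`, and `ρ` is
neither bounded nor finite everywhere, so it is first composed with concave functions that are
eventually constant. The composed functions are test functions up to a constant, and concavity with
the maximum principle for the generator turns `L ρ ≤ C₁ - C₂ ρ` into a drift inequality for them.
Gronwall's inequality then bounds `P_t f x` uniformly in `t` for `f ≤ √(1 + ρ)`, so the measures
`f ↦ P_t f x` are tight when `ρ x < ∞`.

On the other hand, `γ < 1/2` lets the Dunkl gradient control the usual gradient, so that the
gradient bound makes `P_t f` Lipschitz with a constant that decays in `t`. With tightness this shows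
that `t ↦ P_t f x` is Cauchy and that its limit does not depend on `x`; the limit is a tight
positive functional on `C_b`, hence a probability measure by the Riesz–Markov–Kakutani theorem.
-/

noncomputable section

namespace Dunkl

variable {N : ℕ}

/-! ### Dunkl operators -/

theorem refl_apply {α : E N} (hα : ‖α‖ ^ 2 = 2) (x : E N) :
    refl α x = x - (inner ℝ α x) • α := by
  rw [refl, Submodule.reflection_orthogonal_apply, Submodule.reflection_singleton_apply]
  simp only [RCLike.ofReal_real_eq_id, id_eq, hα]
  rw [two_smul, ← add_smul, neg_sub]
  congr 2
  ring

theorem sub_refl_apply {α : E N} (hα : ‖α‖ ^ 2 = 2) (x : E N) :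
    x - refl α x = (inner ℝ α x) • α := by
  rw [refl_apply hα, sub_sub_cancel]

theorem RootData.mem_R {D : RootData N} {α : E N} (h : α ∈ D.Rplus) : α ∈ D.R := by
  obtain ⟨v, -, hv⟩ := D.exists_hyperplane
  exact ((hv α).1 h).1

theorem RootData.k_nonneg_of_mem {D : RootData N} {α : E N} (h : α ∈ D.Rplus) : 0 ≤ D.k α :=
  D.k_nonneg α (D.mem_R h)

theorem RootData.norm_sq_of_mem {D : RootData N} {α : E N} (h : α ∈ D.Rplus) : ‖α‖ ^ 2 = 2 :=
  D.norm_sq α (D.mem_R h)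

theorem RootData.refl_mem_G {D : RootData N} {α : E N} (h : α ∈ D.Rplus) : refl α ∈ D.G :=
  Subgroup.subset_closure ⟨α, D.mem_R h, rfl⟩

/-- A set stable under the reflections `σ_α` with `k_α ≠ 0`, the ones that occur in the Dunkl
operators. On an open stable set the Dunkl operators act like local operators. -/
def ReflStable (D : RootData N) (V : Set (E N)) : Prop :=
  ∀ α ∈ D.Rplus, D.k α ≠ 0 → ∀ x ∈ V, refl α x ∈ V

theorem ReflStable.inter {D : RootData N} {V W : Set (E N)} (hV : ReflStable D V)
    (hW : ReflStable D W) : ReflStable D (V ∩ W) :=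
  fun α hα hk x hx => ⟨hV α hα hk x hx.1, hW α hα hk x hx.2⟩

theorem reflStable_compl_closedBall (D : RootData N) (r : ℝ) :
    ReflStable D (Metric.closedBall (0 : E N) r)ᶜ := by
  intro α _ _ x hx
  simpa using hx

theorem diffQuot_congr {α : E N} {f g : E N → ℝ} {x : E N} (h : f =ᶠ[𝓝 x] g)
    (hα : f (refl α x) = g (refl α x)) : diffQuot α f x = diffQuot α g x := by
  rw [diffQuot, diffQuot, h.fderiv_eq, h.eq_of_nhds, hα]

theorem T_congr {D : RootData N} {V : Set (E N)} (hVo : IsOpen V) (hV : ReflStable D V)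
    {f g : E N → ℝ} (h : Set.EqOn f g V) (i : Fin N) : Set.EqOn (T D i f) (T D i g) V := by
  intro x hx
  have hfg : f =ᶠ[𝓝 x] g := h.eventuallyEq_of_mem (hVo.mem_nhds hx)
  rw [T, T, hfg.fderiv_eq]
  congr 1
  refine Finset.sum_congr rfl fun α hα => ?_
  by_cases hk : D.k α = 0
  · simp [hk]
  · rw [diffQuot_congr hfg (h (hV α hα hk x hx))]

theorem L_congr {D : RootData N} {V : Set (E N)} (hVo : IsOpen V) (hV : ReflStable D V)
    {f g : E N → ℝ} (h : Set.EqOn f g V) (b : E N → E N) : Set.EqOn (L D b f) (L D b g) V := by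
  intro x hx
  rw [L, L]
  refine Finset.sum_congr rfl fun i _ => ?_
  rw [T_congr hVo hV h i hx, T_congr hVo hV (T_congr hVo hV h i) i hx]

section Algebra

variable (D : RootData N) (b : E N → E N)

theorem T_sub_const (i : Fin N) (f : E N → ℝ) (c : ℝ) :
    T D i (fun x => f x - c) = T D i f := by
  funext x
  simp only [T, diffQuot, fderiv_sub_const, sub_sub_sub_cancel_right]

theorem L_sub_const (f : E N → ℝ) (c : ℝ) : L D b (fun x => f x - c) = L D b f := by
  funext x
  simp only [L, T_sub_const]

theorem diffQuot_const_smul (α : E N) (c : ℝ) (f : E N → ℝ) (x : E N) :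
    diffQuot α (c • f) x = c * diffQuot α f x := by
  simp only [diffQuot, fderiv_const_smul_field, Pi.smul_apply, smul_apply, smul_eq_mul, mul_ite,
    ← mul_sub, mul_div_assoc]

theorem T_const_smul (i : Fin N) (c : ℝ) (f : E N → ℝ) : T D i (c • f) = c • T D i f := by
  funext x
  simp only [T, diffQuot_const_smul, fderiv_const_smul_field, Pi.smul_apply, smul_apply,
    smul_eq_mul, mul_add, Finset.mul_sum, mul_left_comm c]

theorem L_const_smul (c : ℝ) (f : E N → ℝ) : L D b (c • f) = c • L D b f := by
  funext x
  simp only [L, T_const_smul, Pi.smul_apply, smul_eq_mul, Finset.mul_sum, mul_add,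
    mul_left_comm c]

theorem T_zero (i : Fin N) : T D i 0 = 0 := by
  simpa using T_const_smul D i 0 0

theorem diffQuot_sub {f g : E N → ℝ} {x : E N} (hf : DifferentiableAt ℝ f x)
    (hg : DifferentiableAt ℝ g x) (α : E N) :
    diffQuot α (f - g) x = diffQuot α f x - diffQuot α g x := by
  unfold diffQuot
  split_ifs
  · rw [fderiv_sub hf hg, sub_apply]
  · rw [← sub_div, Pi.sub_apply, Pi.sub_apply, sub_sub_sub_comm]

theorem T_sub {f g : E N → ℝ} {x : E N} (hf : DifferentiableAt ℝ f x)
    (hg : DifferentiableAt ℝ g x) (i : Fin N) :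
    T D i (f - g) x = T D i f x - T D i g x := by
  simp only [T, diffQuot_sub hf hg, fderiv_sub hf hg, sub_apply, mul_sub, Finset.sum_sub_distrib]
  ring

end Algebra

/-- The set of points that lie on no reflecting hyperplane. -/
def regular (D : RootData N) : Set (E N) := {x | ∀ α ∈ D.R, inner ℝ α x ≠ 0}

theorem regular_eq_biInter (D : RootData N) :
    regular D = ⋂ α ∈ D.R, {x | inner ℝ α x ≠ 0} := by
  ext
  simp [regular]

theorem isOpen_regular (D : RootData N) : IsOpen (regular D) := by
  rw [regular_eq_biInter]
  exact isOpen_biInter_finset fun α _ => isOpen_ne_fun (by fun_prop) (by fun_prop)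

theorem reflStable_regular (D : RootData N) : ReflStable D (regular D) := by
  intro α hα _ x hx β hβ
  have h := hx _ (D.refl_mem α (D.mem_R hα) β hβ)
  rwa [← (refl α).inner_map_map, refl, Submodule.reflection_reflection] at h

theorem dense_inner_ne_zero {α : E N} (hα : α ≠ 0) : Dense {x : E N | inner ℝ α x ≠ 0} := by
  let K : Submodule ℝ (E N) := LinearMap.ker (innerSL ℝ α).toLinearMap
  have hK : K ≠ ⊤ := fun h => by
    have hα_mem : α ∈ K := h ▸ Submodule.mem_top
    simp [K, hα] at hα_mem
  have hcompl : {x : E N | inner ℝ α x ≠ 0} = (K : Set (E N))ᶜ := by ext; simp [K]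
  rw [hcompl, ← interior_eq_empty_iff_dense_compl, ← Set.not_nonempty_iff_eq_empty]
  exact fun h => hK (K.eq_top_of_nonempty_interior' h)

theorem dense_regular (D : RootData N) : Dense (regular D) := by
  rw [regular_eq_biInter]
  exact dense_biInter_of_isOpen (fun α _ => isOpen_ne_fun (by fun_prop) (by fun_prop))
    D.R.countable_toSet fun α hα => dense_inner_ne_zero fun h => D.zero_notMem (h ▸ hα)

theorem diffQuot_of_regular {D : RootData N} {α : E N} (hα : α ∈ D.Rplus) (f : E N → ℝ) {x : E N}
    (hx : x ∈ regular D) : diffQuot α f x = (f x - f (refl α x)) / inner ℝ α x := by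
  rw [diffQuot, if_neg (hx α (D.mem_R hα))]

theorem contDiffOn_T {D : RootData N} {W : Set (E N)} (hWo : IsOpen W) (hW : ReflStable D W)
    (hreg : W ⊆ regular D) {n : WithTop ℕ∞} {f : E N → ℝ} (hf : ContDiffOn ℝ (n + 1) f W)
    (i : Fin N) : ContDiffOn ℝ n (T D i f) W := by
  refine ContDiffOn.add ?_ (ContDiffOn.sum fun α hα => ?_)
  · exact (hf.fderiv_of_isOpen hWo le_rfl).clm_apply contDiffOn_const
  by_cases hk : D.k α = 0
  · simpa [hk] using contDiffOn_const
  have hfn : ContDiffOn ℝ n f W := hf.of_le le_self_add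
  have hrefl : ContDiffOn ℝ n (fun x => f (refl α x)) W :=
    hfn.comp (refl α).contDiff.contDiffOn fun x hx => hW α hα hk x hx
  refine contDiffOn_const.mul (ContDiffOn.congr ?_ fun x hx => diffQuot_of_regular hα f (hreg hx))
  exact (hfn.sub hrefl).div (innerSL ℝ α).contDiff.contDiffOn fun x hx =>
    hreg hx α (D.mem_R hα)

theorem L_sub {D : RootData N} {W : Set (E N)} (hWo : IsOpen W) (hW : ReflStable D W)
    (hreg : W ⊆ regular D) {f g : E N → ℝ} (hf : ContDiffOn ℝ 2 f W) (hg : ContDiffOn ℝ 2 g W)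
    (b : E N → E N) : Set.EqOn (L D b (f - g)) (L D b f - L D b g) W := by
  intro x hx
  have diffAt {h : E N → ℝ} (hh : ContDiffOn ℝ 1 h W) {y : E N} (hy : y ∈ W) :
      DifferentiableAt ℝ h y :=
    (hh.contDiffAt (hWo.mem_nhds hy)).differentiableAt one_ne_zero
  have hT (i : Fin N) : Set.EqOn (T D i (f - g)) (T D i f - T D i g) W := fun y hy =>
    T_sub D (diffAt (hf.of_le one_le_two) hy) (diffAt (hg.of_le one_le_two) hy) i
  have hTT (i : Fin N) : T D i (T D i (f - g)) x = T D i (T D i f) x - T D i (T D i g) x := by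
    rw [T_congr hWo hW (hT i) i hx]
    exact T_sub D (diffAt (contDiffOn_T hWo hW hreg (by simpa [one_add_one_eq_two] using hf) i) hx)
      (diffAt (contDiffOn_T hWo hW hreg (by simpa [one_add_one_eq_two] using hg) i) hx) i
  simp only [L, hTT, hT _ hx, Pi.sub_apply, ← Finset.sum_sub_distrib]
  exact Finset.sum_congr rfl fun i _ => by ring

theorem tendsto_div_inner_of_hasStrictFDerivAt {α : E N} (hα : ‖α‖ ^ 2 = 2) {f : E N → ℝ}
    {f' : E N →L[ℝ] ℝ} {x₀ : E N} (hf : HasStrictFDerivAt f f' x₀) (h₀ : inner ℝ α x₀ = 0) :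
    Tendsto (fun x => (f x - f (refl α x)) / inner ℝ α x) (𝓝[{x | inner ℝ α x ≠ 0}] x₀)
      (𝓝 (f' α)) := by
  have hpair : Tendsto (fun x => (x, refl α x)) (𝓝 x₀) (𝓝 (x₀, x₀)) := by
    have hcont : Continuous fun x => (x, refl α x) := by fun_prop
    simpa [refl_apply hα x₀, h₀] using hcont.tendsto x₀
  have hlittle : (fun x => f x - f (refl α x) - inner ℝ α x * f' α) =o[𝓝 x₀]
      fun x => (inner ℝ α x : ℝ) := by
    have h := hf.isLittleO.comp_tendsto hpair
    simp only [Function.comp_def, sub_refl_apply hα, map_smul, smul_eq_mul] at h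
    exact h.trans_isBigO (Asymptotics.isBigO_of_le' (c := ‖α‖) _ fun x => by
      rw [norm_smul, mul_comm])
  have hzero := (hlittle.tendsto_div_nhds_zero.mono_left
    (nhdsWithin_le_nhds (s := {x | inner ℝ α x ≠ 0}))).add_const (f' α)
  rw [zero_add] at hzero
  refine hzero.congr' ?_
  filter_upwards [self_mem_nhdsWithin] with x hx
  rw [sub_div, mul_div_cancel_left₀ _ hx, sub_add_cancel]

theorem continuous_diffQuot {α : E N} (hα : ‖α‖ ^ 2 = 2) {f : E N → ℝ} (hf : ContDiff ℝ 1 f) :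
    Continuous (diffQuot α f) := by
  refine continuous_iff_continuousAt.2 fun x₀ => ?_
  have hinner : Continuous fun x : E N => (inner ℝ α x : ℝ) := by fun_prop
  by_cases h₀ : inner ℝ α x₀ = 0
  · rw [ContinuousAt, show diffQuot α f x₀ = fderiv ℝ f x₀ α from if_pos h₀]
    refine Tendsto.if (Tendsto.mono_left ?_ inf_le_left)
      (tendsto_div_inner_of_hasStrictFDerivAt hα (hf.contDiffAt.hasStrictFDerivAt one_ne_zero) h₀)
    exact ((hf.continuous_fderiv one_ne_zero).clm_apply continuous_const).tendsto x₀
  · have hquot : ContinuousAt (fun x => (f x - f (refl α x)) / inner ℝ α x) x₀ :=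
      (hf.continuous.sub (hf.continuous.comp (refl α).continuous)).continuousAt.div
        hinner.continuousAt h₀
    refine hquot.congr ?_
    filter_upwards [hinner.continuousAt.eventually_ne h₀] with x hx
    rw [diffQuot, if_neg hx]

theorem continuous_T (D : RootData N) {f : E N → ℝ} (hf : ContDiff ℝ 1 f) (i : Fin N) :
    Continuous (T D i f) := by
  refine Continuous.add ?_ (continuous_finsetSum _ fun α hα => ?_)
  · exact (hf.continuous_fderiv one_ne_zero).clm_apply continuous_const
  · exact continuous_const.mul (continuous_diffQuot (D.norm_sq_of_mem hα) hf)

theorem continuous_symGrad (D : RootData N) {f : E N → ℝ} (hf : ContDiff ℝ 1 f) :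
    Continuous (symGrad D f) :=
  continuous_finsetSum _ fun g _ => continuous_finsetSum _ fun i _ =>
    ((continuous_T D hf i).comp g.1.continuous).pow 2

theorem hasCompactSupport_symGrad (D : RootData N) {f : E N → ℝ} (hf : HasCompactSupport f) :
    HasCompactSupport (symGrad D f) := by
  obtain ⟨r, hr⟩ := hf.isBounded.subset_closedBall (0 : E N)
  refine HasCompactSupport.intro (isCompact_closedBall (0 : E N) r) fun x hx => ?_
  have hzero : Set.EqOn f 0 (Metric.closedBall (0 : E N) r)ᶜ := fun y hy =>
    image_eq_zero_of_notMem_tsupport fun h => hy (hr h)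
  refine Finset.sum_eq_zero fun g _ => Finset.sum_eq_zero fun i _ => ?_
  have hgx : g.1 x ∈ (Metric.closedBall (0 : E N) r)ᶜ := by simpa using hx
  rw [T_congr Metric.isClosed_closedBall.isOpen_compl (reflStable_compl_closedBall D r) hzero i hgx,
    T_zero, Pi.zero_apply, zero_pow two_ne_zero]

theorem exists_bcf_symGrad (D : RootData N) {f : E N →ᵇ ℝ} (hf : IsTest f) :
    ∃ g : E N →ᵇ ℝ, ∀ x, g x = symGrad D f x :=
  have hcont := continuous_symGrad D (hf.1.of_le (by simp))
  have ⟨C, hC⟩ := (hasCompactSupport_symGrad D hf.2).exists_bound_of_continuous hcont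
  ⟨.ofNormedAddCommGroup _ hcont C hC, fun _ => rfl⟩

/-! ### Markov semigroups and their generators -/

open BoundedContinuousFunction in
/-- A function of the form `f + c` with a test function `f` and a constant `c`. -/
def IsTestAddConst (u : E N →ᵇ ℝ) : Prop := ∃ c : ℝ, IsTest (u - const (E N) c)

namespace MarkovSemigroup

section Contraction

variable (S : MarkovSemigroup N)

theorem mono (t : ℝ≥0) {f g : E N →ᵇ ℝ} (h : ∀ x, f x ≤ g x) (x : E N) : S.P t f x ≤ S.P t g x := by
  simpa using S.nonneg t (g - f) (fun y => by simpa using h y) x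

theorem P_const (t : ℝ≥0) (c : ℝ) :
    S.P t (BoundedContinuousFunction.const (E N) c) = BoundedContinuousFunction.const (E N) c := by
  have hconst : BoundedContinuousFunction.const (E N) c =
      c • BoundedContinuousFunction.const (E N) (1 : ℝ) := by ext; simp
  rw [hconst, map_smul, S.one]

theorem P_le_of_le (t : ℝ≥0) {f : E N →ᵇ ℝ} {c : ℝ} (h : ∀ x, f x ≤ c) (x : E N) :
    S.P t f x ≤ c := by
  simpa [P_const] using S.mono t (g := BoundedContinuousFunction.const (E N) c) h x

theorem norm_P_le (t : ℝ≥0) (f : E N →ᵇ ℝ) : ‖S.P t f‖ ≤ ‖f‖ := by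
  refine (BoundedContinuousFunction.norm_le (norm_nonneg f)).2 fun x => abs_le'.2 ⟨?_, ?_⟩
  · exact S.P_le_of_le t (fun y => (le_abs_self _).trans (f.norm_coe_le_norm y)) x
  · have h := S.P_le_of_le t (f := -f) (fun y => (neg_le_abs _).trans (f.norm_coe_le_norm y)) x
    rwa [map_neg] at h

/-- The operator `P_t` as a continuous linear map. -/
def clm (t : ℝ≥0) : (E N →ᵇ ℝ) →L[ℝ] (E N →ᵇ ℝ) :=
  (S.P t).mkContinuous 1 fun f => by simpa using S.norm_P_le t f

@[simp]
theorem clm_apply (t : ℝ≥0) (f : E N →ᵇ ℝ) : S.clm t f = S.P t f := rfl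

theorem norm_P_sub_P_le (r s : ℝ≥0) (f : E N →ᵇ ℝ) :
    ‖S.P r f - S.P s f‖ ≤ ‖S.P (nndist r s) f - f‖ := by
  wlog h : s ≤ r generalizing r s
  · rw [norm_sub_rev, nndist_comm]
    exact this s r (le_of_not_ge h)
  have hdist : nndist r s = r - s := by
    rw [NNReal.nndist_eq, tsub_eq_zero_of_le h, max_eq_left zero_le]
  calc ‖S.P r f - S.P s f‖ = ‖S.P s (S.P (r - s) f - f)‖ := by
        rw [map_sub, ← S.add, add_tsub_cancel_of_le h]
    _ ≤ ‖S.P (nndist r s) f - f‖ := hdist ▸ S.norm_P_le s _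

end Contraction

/-- `u` belongs to the domain of the generator of the semigroup, and the generator maps it
to `l`. -/
def HasGenerator (S : MarkovSemigroup N) (u l : E N →ᵇ ℝ) : Prop :=
  Tendsto (fun t : ℝ≥0 => (t : ℝ)⁻¹ • (S.P t u - u)) (𝓝[>] 0) (𝓝 l)

variable {S : MarkovSemigroup N} {u l : E N →ᵇ ℝ}

namespace HasGenerator

theorem tendsto_apply (h : S.HasGenerator u l) (x : E N) :
    Tendsto (fun t : ℝ≥0 => (t : ℝ)⁻¹ * (S.P t u x - u x)) (𝓝[>] 0) (𝓝 (l x)) :=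
  ((BoundedContinuousFunction.evalCLM ℝ x).continuous.tendsto l).comp h

theorem nonpos_of_forall_le (h : S.HasGenerator u l) {x : E N} (hx : ∀ y, u y ≤ u x) :
    l x ≤ 0 :=
  le_of_tendsto' (h.tendsto_apply x) fun t =>
    mul_nonpos_of_nonneg_of_nonpos (inv_nonneg.2 t.2) (sub_nonpos.2 (S.P_le_of_le t hx x))

theorem tendsto_zero (h : S.HasGenerator u l) : Tendsto (fun t => S.P t u) (𝓝 0) (𝓝 u) := by
  have hpos : Tendsto (fun t => S.P t u) (𝓝[>] 0) (𝓝 u) := by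
    have hcoe : Tendsto (fun t : ℝ≥0 => (t : ℝ)) (𝓝[>] 0) (𝓝 0) :=
      (NNReal.continuous_coe.tendsto 0).mono_left nhdsWithin_le_nhds
    have hlim := (hcoe.smul h).add_const u
    rw [zero_smul, zero_add] at hlim
    refine hlim.congr' ?_
    filter_upwards [self_mem_nhdsWithin] with t ht
    rw [smul_inv_smul₀ (NNReal.coe_ne_zero.2 (ne_of_gt ht)), sub_add_cancel]
  have hzero : ContinuousWithinAt (fun t => S.P t u) (Set.Ioi 0) 0 := by
    rwa [ContinuousWithinAt, S.zero]
  rw [continuousWithinAt_Ioi_iff_Ici, ← bot_eq_zero', Set.Ici_bot, continuousWithinAt_univ,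
    ContinuousAt, bot_eq_zero', S.zero] at hzero
  exact hzero

theorem continuous_P (h : S.HasGenerator u l) : Continuous fun t => S.P t u := by
  refine continuous_iff_continuousAt.2 fun s => tendsto_iff_norm_sub_tendsto_zero.2 ?_
  have hdist : Tendsto (fun r => nndist r s) (𝓝 s) (𝓝 0) := by
    simpa using (continuous_id.nndist (continuous_const (y := s))).tendsto s
  exact squeeze_zero (fun _ => norm_nonneg _) (fun r => S.norm_P_sub_P_le r s u)
    (tendsto_iff_norm_sub_tendsto_zero.1 (h.tendsto_zero.comp hdist))

theorem hasDerivWithinAt_P (h : S.HasGenerator u l) {s : ℝ} (hs : 0 ≤ s) :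
    HasDerivWithinAt (fun z : ℝ => S.P z.toNNReal u) (S.P s.toNNReal l) (Set.Ici s) s := by
  rw [← hasDerivWithinAt_Ioi_iff_Ici, hasDerivWithinAt_iff_tendsto_slope' Set.self_notMem_Ioi]
  have hincr : Tendsto (fun z : ℝ => (z - s).toNNReal) (𝓝[>] s) (𝓝[>] 0) := by
    refine tendsto_nhdsWithin_iff.2 ⟨?_, ?_⟩
    · have hcont : Continuous fun z : ℝ => (z - s).toNNReal := by fun_prop
      simpa using (hcont.tendsto s).mono_left nhdsWithin_le_nhds
    · filter_upwards [self_mem_nhdsWithin] with z hz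
      simpa using hz
  refine (((S.clm s.toNNReal).continuous.tendsto l).comp (h.comp hincr)).congr' ?_
  filter_upwards [self_mem_nhdsWithin] with z hz
  have hsz : s ≤ z := le_of_lt hz
  have hz_eq : s.toNNReal + (z - s).toNNReal = z.toNNReal := by
    rw [← Real.toNNReal_add hs (sub_nonneg.2 hsz), add_sub_cancel]
  simp only [Function.comp_apply, clm_apply, map_smul, map_sub, ← S.add, hz_eq, slope_def_module,
    Real.coe_toNNReal _ (sub_nonneg.2 hsz)]

theorem P_apply_le_gronwallBound (h : S.HasGenerator u l) {t : ℝ≥0} {x : E N} {K ε : ℝ}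
    (hl : ∀ s ≤ t, S.P s l x ≤ K * S.P s u x + ε) :
    S.P t u x ≤ gronwallBound (u x) K ε t := by
  let ev := BoundedContinuousFunction.evalCLM ℝ x (α := E N) (β := ℝ)
  have hcont : Continuous fun s : ℝ => S.P s.toNNReal u x :=
    ev.continuous.comp (h.continuous_P.comp continuous_real_toNNReal)
  have hderiv : ∀ s ∈ Set.Ico (0 : ℝ) t,
      HasDerivWithinAt (fun z : ℝ => S.P z.toNNReal u x) (S.P s.toNNReal l x) (Set.Ici s) s :=
    fun s hs => ev.hasFDerivAt.comp_hasDerivWithinAt s (h.hasDerivWithinAt_P hs.1)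
  have hbound : ∀ s ∈ Set.Ico (0 : ℝ) t,
      S.P s.toNNReal l x ≤ K * S.P s.toNNReal u x + ε :=
    fun s hs => hl _ (Real.toNNReal_le_iff_le_coe.2 hs.2.le)
  have hgronwall := le_gronwallBound_of_liminf_deriv_right_le (δ := u x) hcont.continuousOn
    (fun s hs _ hr => (hderiv s hs).liminf_right_slope_le hr)
    (by rw [Real.toNNReal_zero, S.zero]) hbound t ⟨t.2, le_rfl⟩
  simpa using hgronwall

end HasGenerator

namespace IsGeneratedBy

variable {D : RootData N} {b : E N → E N}

theorem exists_bcf_L (hS : S.IsGeneratedBy D b) {f : E N →ᵇ ℝ} (hf : IsTest f) :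
    ∃ l : E N →ᵇ ℝ, ∀ x, l x = L D b f x := by
  have hcont : Continuous (L D b f) := (hS f hf).continuous (Frequently.of_forall fun t =>
    ((S.P t f).continuous.sub f.continuous).div_const _)
  obtain ⟨t, ht⟩ := (Metric.tendstoUniformly_iff.1 (hS f hf) 1 one_pos).exists
  let q : E N →ᵇ ℝ := (t : ℝ)⁻¹ • (S.P t f - f)
  refine ⟨.ofNormedAddCommGroup (L D b f) hcont (‖q‖ + 1) fun x => ?_, fun _ => rfl⟩
  have hdist : ‖L D b f x - q x‖ ≤ 1 := by
    simpa [q, div_eq_inv_mul, dist_eq_norm] using (ht x).le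
  calc ‖L D b f x‖ ≤ ‖q x‖ + ‖L D b f x - q x‖ := norm_le_norm_add_norm_sub' _ _
    _ ≤ ‖q‖ + 1 := add_le_add (q.norm_coe_le_norm x) hdist

theorem exists_hasGenerator (hS : S.IsGeneratedBy D b) (hu : IsTestAddConst u) :
    ∃ l : E N →ᵇ ℝ, S.HasGenerator u l ∧ ∀ x, l x = L D b u x := by
  obtain ⟨c, hf⟩ := hu
  obtain ⟨l, hl⟩ := hS.exists_bcf_L hf
  refine ⟨l, ?_, fun x => by rw [hl, ← L_sub_const D b u c]; rfl⟩
  rw [HasGenerator, BoundedContinuousFunction.tendsto_iff_tendstoUniformly, funext hl]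
  convert hS _ hf using 3 with t x
  simp [P_const, div_eq_inv_mul]

theorem L_nonpos_of_forall_le (hS : S.IsGeneratedBy D b) (hu : IsTestAddConst u) {x : E N}
    (hx : ∀ y, u y ≤ u x) : L D b u x ≤ 0 := by
  obtain ⟨l, hl, hlL⟩ := hS.exists_hasGenerator hu
  exact hlL x ▸ hl.nonpos_of_forall_le hx

theorem P_apply_le_gronwallBound (hS : S.IsGeneratedBy D b) (hu : IsTestAddConst u)
    {H : E N →ᵇ ℝ} (hH : ∀ y, L D b u y ≤ H y) {t : ℝ≥0} {x : E N} {K ε : ℝ}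
    (hK : ∀ s ≤ t, S.P s H x ≤ K * S.P s u x + ε) : S.P t u x ≤ gronwallBound (u x) K ε t := by
  obtain ⟨l, hl, hlL⟩ := hS.exists_hasGenerator hu
  exact hl.P_apply_le_gronwallBound fun s hs =>
    (S.mono s (fun y => (hlL y).trans_le (hH y)) x).trans (hK s hs)

end IsGeneratedBy

end MarkovSemigroup

/-! ### Truncation of Lyapunov functions -/

theorem le_tangent_of_concaveOn {S : Set ℝ} {f : ℝ → ℝ} {f' r s : ℝ} (hf : ConcaveOn ℝ S f)
    (hr : r ∈ S) (hs : s ∈ S) (hderiv : HasDerivAt f f' r) : f s ≤ f r + f' * (s - r) := by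
  rcases lt_trichotomy s r with hsr | rfl | hrs
  · have hslope := hf.le_slope_of_hasDerivAt hs hr hsr hderiv
    rw [slope_def_field, le_div_iff₀ (sub_pos.2 hsr)] at hslope
    linarith
  · simp
  · have hslope := hf.slope_le_of_hasDerivAt hr hs hrs hderiv
    rw [slope_def_field, div_le_iff₀ (sub_pos.2 hrs)] at hslope
    linarith

/-- A smooth nonincreasing function with value `1` on `(-∞, 1]` and `0` on `[2, ∞)`. -/
def cutoff (z : ℝ) : ℝ := 1 - Real.smoothTransition (z - 1)

theorem contDiff_cutoff : ContDiff ℝ ∞ cutoff :=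
  contDiff_const.sub (Real.smoothTransition.contDiff.comp (contDiff_id.sub contDiff_const))

theorem antitone_cutoff : Antitone cutoff := fun _ _ h =>
  sub_le_sub_left (Real.smoothTransition.monotone (sub_le_sub_right h 1)) 1

theorem cutoff_of_le_one {z : ℝ} (hz : z ≤ 1) : cutoff z = 1 := by
  rw [cutoff, Real.smoothTransition.zero_of_nonpos (sub_nonpos.2 hz), sub_zero]

theorem cutoff_of_two_le {z : ℝ} (hz : 2 ≤ z) : cutoff z = 0 := by
  rw [cutoff, Real.smoothTransition.one_of_one_le (by linarith), sub_self]

theorem cutoff_nonneg (z : ℝ) : 0 ≤ cutoff z :=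
  sub_nonneg.2 (Real.smoothTransition.le_one _)

theorem cutoff_le_one (z : ℝ) : cutoff z ≤ 1 :=
  sub_le_self 1 (Real.smoothTransition.nonneg _)

/-- The primitive of `cutoff`: a smooth concave function that is the identity on `(-∞, 1]` and
constant on `[2, ∞)`. It is used to truncate unbounded functions. -/
def truncation (z : ℝ) : ℝ := ∫ s in 0..z, cutoff s

theorem hasDerivAt_truncation (z : ℝ) : HasDerivAt truncation (cutoff z) z :=
  contDiff_cutoff.continuous.integral_hasStrictDerivAt 0 z |>.hasDerivAt

theorem deriv_truncation : deriv truncation = cutoff :=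
  funext fun z => (hasDerivAt_truncation z).deriv

theorem contDiff_truncation : ContDiff ℝ ∞ truncation :=
  contDiff_infty_iff_deriv.2
    ⟨fun z => (hasDerivAt_truncation z).differentiableAt, deriv_truncation ▸ contDiff_cutoff⟩

theorem concaveOn_truncation : ConcaveOn ℝ Set.univ truncation :=
  Antitone.concaveOn_univ_of_deriv (fun z => (hasDerivAt_truncation z).differentiableAt)
    (deriv_truncation ▸ antitone_cutoff)

theorem monotone_truncation : Monotone truncation :=
  monotone_of_deriv_nonneg (fun z => (hasDerivAt_truncation z).differentiableAt)
    fun z => deriv_truncation ▸ cutoff_nonneg z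

theorem truncation_of_le_one {z : ℝ} (hz : z ≤ 1) : truncation z = z := by
  have hone : Set.EqOn cutoff (fun _ => 1) (Set.uIcc 0 z) := fun s hs =>
    cutoff_of_le_one (hs.2.trans (max_le zero_le_one hz))
  rw [truncation, intervalIntegral.integral_congr hone, intervalIntegral.integral_const]
  simp

theorem truncation_of_two_le {z : ℝ} (hz : 2 ≤ z) : truncation z = truncation 2 := by
  have hzero : Set.EqOn cutoff (fun _ => 0) (Set.uIcc 2 z) := fun s hs =>
    cutoff_of_two_le (by rw [Set.uIcc_of_le hz] at hs; exact hs.1)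
  have hint (a c : ℝ) : IntervalIntegrable cutoff volume a c :=
    contDiff_cutoff.continuous.intervalIntegrable a c
  rw [truncation, ← intervalIntegral.integral_add_adjacent_intervals (hint 0 2) (hint 2 z),
    intervalIntegral.integral_congr hzero, intervalIntegral.integral_zero, add_zero, truncation]

theorem truncation_le_self (z : ℝ) : truncation z ≤ z := by
  have htangent := le_tangent_of_concaveOn concaveOn_truncation (Set.mem_univ 1) (Set.mem_univ z)
    (hasDerivAt_truncation 1)
  rw [truncation_of_le_one le_rfl, cutoff_of_le_one le_rfl] at htangent
  linarith

theorem min_one_le_truncation (z : ℝ) : min z 1 ≤ truncation z := by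
  rw [← truncation_of_le_one (min_le_right z 1)]
  exact monotone_truncation (min_le_left z 1)

theorem truncation_le_truncation_two (z : ℝ) : truncation z ≤ truncation 2 :=
  (monotone_truncation (le_max_left z 2)).trans_eq (truncation_of_two_le (le_max_right z 2))

theorem one_le_truncation_two : 1 ≤ truncation 2 := by
  simpa using min_one_le_truncation 2

/-- A function `Φ` on `(-1, ∞)` that is smooth, concave and eventually equal to the constant `c`;
it is composed with a Lyapunov function to obtain bounded functions. -/
structure IsConcaveProfile (Φ : ℝ → ℝ) (c : ℝ) : Prop where
  contDiffOn : ContDiffOn ℝ ∞ Φ (Set.Ioi (-1))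
  concaveOn : ConcaveOn ℝ (Set.Ioi (-1)) Φ
  eq_of_ge : ∃ M, ∀ r ≥ M, Φ r = c

namespace IsConcaveProfile

variable {Φ : ℝ → ℝ} {c : ℝ} (h : IsConcaveProfile Φ c)
include h

theorem le_tangent {r s : ℝ} (hr : -1 < r) (hs : -1 < s) :
    Φ s ≤ Φ r + deriv Φ r * (s - r) :=
  le_tangent_of_concaveOn h.concaveOn hr hs <| DifferentiableAt.hasDerivAt <|
    (h.contDiffOn.contDiffAt (Ioi_mem_nhds hr)).differentiableAt (by simp)

theorem apply_le {r : ℝ} (hr : -1 < r) : Φ r ≤ c := by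
  obtain ⟨M, hM⟩ := h.eq_of_ge
  have hs : M < max M 0 + 1 := (le_max_left M 0).trans_lt (lt_add_one _)
  have hs' : -1 < max M 0 + 1 := by linarith [le_max_right M 0]
  have hconst : Φ =ᶠ[𝓝 (max M 0 + 1)] fun _ => c := by
    filter_upwards [Ioi_mem_nhds hs] with y hy using hM y (le_of_lt hy)
  simpa [hconst.deriv_eq, hM _ hs.le] using h.le_tangent hs' hr

theorem deriv_nonneg {r : ℝ} (hr : -1 < r) : 0 ≤ deriv Φ r := by
  obtain ⟨M, hM⟩ := h.eq_of_ge
  have hr_lt : r < max M r + 1 := (le_max_right M r).trans_lt (lt_add_one _)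
  have htangent := h.le_tangent hr (hr.trans hr_lt)
  rw [hM _ ((le_max_left M r).trans (le_add_of_nonneg_right zero_le_one))] at htangent
  exact nonneg_of_mul_nonneg_left (by linarith [h.apply_le hr]) (sub_pos.2 hr_lt)

end IsConcaveProfile

theorem isConcaveProfile_truncation {φ : ℝ → ℝ} (hφ : ContDiffOn ℝ ∞ φ (Set.Ioi (-1)))
    (hconc : ConcaveOn ℝ (Set.Ioi (-1)) φ) (htop : Tendsto φ atTop atTop) {n : ℝ} (hn : 0 < n) :
    IsConcaveProfile (fun r => n * truncation (φ r / n)) (n * truncation 2) where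
  contDiffOn := contDiffOn_const.mul (contDiff_truncation.comp_contDiffOn (hφ.div_const n))
  concaveOn := by
    have hdiv : ConcaveOn ℝ (Set.Ioi (-1)) fun r => φ r / n := by
      simpa [div_eq_inv_mul] using hconc.smul (inv_nonneg.2 hn.le)
    have himage : Convex ℝ ((fun r => φ r / n) '' Set.Ioi (-1)) :=
      (isPreconnected_Ioi.image _ (hφ.continuousOn.div_const n)).ordConnected.convex
    exact ((concaveOn_truncation.subset (Set.subset_univ _) himage).comp hdiv
      (monotone_truncation.monotoneOn _)).smul hn.le
  eq_of_ge := by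
    obtain ⟨M, hM⟩ := (htop.eventually_ge_atTop (2 * n)).exists_forall_of_atTop
    exact ⟨M, fun r hr => by rw [truncation_of_two_le ((le_div_iff₀ hn).2 (hM r hr))]⟩

section StableNeighbourhoods

/-- The group generated by the reflections `σ_α` with `k_α ≠ 0`. -/
def activeGroup (D : RootData N) : Subgroup (E N ≃ₗᵢ[ℝ] E N) :=
  Subgroup.closure {g | ∃ α ∈ D.Rplus, D.k α ≠ 0 ∧ g = refl α}

theorem activeGroup_le (D : RootData N) : activeGroup D ≤ D.G :=
  (Subgroup.closure_le _).2 fun _ ⟨_, hα, _, hg⟩ => hg ▸ D.refl_mem_G hα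

instance finite_activeGroup (D : RootData N) : Finite (activeGroup D) :=
  Finite.of_injective _ (Subgroup.inclusion_injective (activeGroup_le D))

theorem ReflStable.map_mem_iff {D : RootData N} {V : Set (E N)} (hV : ReflStable D V)
    {g : E N ≃ₗᵢ[ℝ] E N} (hg : g ∈ activeGroup D) (x : E N) : g x ∈ V ↔ x ∈ V := by
  induction hg using Subgroup.closure_induction generalizing x with
  | mem g hg =>
    obtain ⟨α, hα, hk, rfl⟩ := hg
    refine ⟨fun h => ?_, hV α hα hk x⟩
    simpa only [refl, Submodule.reflection_reflection] using hV α hα hk _ h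
  | one => rfl
  | mul g h _ _ ihg ihh => exact (ihg (h x)).trans (ihh x)
  | inv g _ ih =>
    exact (ih (g⁻¹ x)).symm.trans (iff_of_eq (congrArg (· ∈ V) (g.apply_symm_apply x)))

theorem exists_reflStable_subset {D : RootData N} {U : Set (E N)} (hU : IsOpen U) {x : E N}
    (hx : ∀ g ∈ activeGroup D, g x ∈ U) :
    ∃ W ⊆ U, IsOpen W ∧ ReflStable D W ∧ x ∈ W := by
  refine ⟨⋂ g : activeGroup D, g.1 ⁻¹' U, Set.iInter_subset_of_subset 1 fun y hy => hy,
    isOpen_iInter_of_finite fun g => hU.preimage g.1.continuous, fun α hα hk y hy => ?_,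
    Set.mem_iInter.2 fun g => hx g.1 g.2⟩
  have hrefl : refl α ∈ activeGroup D := Subgroup.subset_closure ⟨α, hα, hk, rfl⟩
  exact Set.mem_iInter.2 fun g => (Set.mem_iInter.1 hy (g * ⟨refl α, hrefl⟩) :)

end StableNeighbourhoods

theorem neg_one_lt_toReal (a : ℝ≥0∞) : -1 < a.toReal :=
  neg_one_lt_zero.trans_le ENNReal.toReal_nonneg

/-- The composition of `Φ : [0, ∞) → ℝ` with `ρ`, with the value `c` where `ρ = ∞`. -/
def lyapunovComp (ρ : E N → ℝ≥0∞) (Φ : ℝ → ℝ) (c : ℝ) (x : E N) : ℝ :=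
  if ρ x = ⊤ then c else Φ (ρ x).toReal

theorem lyapunovComp_of_eq_top {ρ : E N → ℝ≥0∞} {x : E N} (hx : ρ x = ⊤) (Φ : ℝ → ℝ) (c : ℝ) :
    lyapunovComp ρ Φ c x = c := if_pos hx

theorem lyapunovComp_of_ne_top {ρ : E N → ℝ≥0∞} {x : E N} (hx : ρ x ≠ ⊤) (Φ : ℝ → ℝ) (c : ℝ) :
    lyapunovComp ρ Φ c x = Φ (ρ x).toReal := if_neg hx

theorem lyapunovComp_of_lt {ρ : E N → ℝ≥0∞} {Φ : ℝ → ℝ} {c : ℝ} {M : ℝ≥0}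
    (hM : ∀ r ≥ (M : ℝ), Φ r = c) {x : E N} (hx : M < ρ x) : lyapunovComp ρ Φ c x = c := by
  by_cases htop : ρ x = ⊤
  · exact lyapunovComp_of_eq_top htop Φ c
  · rw [lyapunovComp_of_ne_top htop]
    exact hM _ ((ENNReal.toReal_le_toReal ENNReal.coe_ne_top htop).2 hx.le)

namespace IsLyapunov

variable {D : RootData N} {b : E N → E N} {ρ : E N → ℝ≥0∞} (hρ : IsLyapunov D b ρ)
include hρ

theorem isOpen_ne_top : IsOpen {x | ρ x ≠ ⊤} := isOpen_ne_fun hρ.continuous continuous_const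

theorem contDiffAt_comp {Φ : ℝ → ℝ} (hΦ : ContDiffOn ℝ ∞ Φ (Set.Ioi (-1))) (c : ℝ) {x : E N}
    (hx : ρ x ≠ ⊤) : ContDiffAt ℝ ∞ (lyapunovComp ρ Φ c) x := by
  have hcomp : ContDiffAt ℝ ∞ (fun y => Φ (ρ y).toReal) x :=
    (hΦ.contDiffAt (Ioi_mem_nhds (neg_one_lt_toReal _))).comp x
      (hρ.smooth.contDiffAt (hρ.isOpen_ne_top.mem_nhds hx))
  refine hcomp.congr_of_eventuallyEq ?_
  filter_upwards [hρ.isOpen_ne_top.mem_nhds hx] with y hy using lyapunovComp_of_ne_top hy Φ c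

theorem contDiff_comp {Φ : ℝ → ℝ} (hΦ : ContDiffOn ℝ ∞ Φ (Set.Ioi (-1))) {c : ℝ} {M : ℝ≥0}
    (hM : ∀ r ≥ (M : ℝ), Φ r = c) : ContDiff ℝ ∞ (lyapunovComp ρ Φ c) := by
  refine contDiff_iff_contDiffAt.2 fun x => ?_
  by_cases hx : ρ x = ⊤
  · refine (contDiffAt_const (c := c)).congr_of_eventuallyEq ?_
    have hlt : (M : ℝ≥0∞) < ρ x := hx ▸ ENNReal.coe_lt_top
    filter_upwards [hρ.continuous.continuousAt.eventually (lt_mem_nhds hlt)] with y hy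
      using lyapunovComp_of_lt hM hy
  · exact hρ.contDiffAt_comp hΦ c hx

theorem exists_isTestAddConst_comp {Φ : ℝ → ℝ} (hΦ : ContDiffOn ℝ ∞ Φ (Set.Ioi (-1))) {c M : ℝ}
    (hM : ∀ r ≥ M, Φ r = c) :
    ∃ u : E N →ᵇ ℝ, (∀ x, u x = lyapunovComp ρ Φ c x) ∧ IsTestAddConst u := by
  let M' : ℝ≥0 := max M.toNNReal 1
  have hM' : ∀ r ≥ (M' : ℝ), Φ r = c := fun r hr => hM r <|
    (Real.le_coe_toNNReal M).trans ((NNReal.coe_le_coe.2 (le_max_left _ _)).trans hr)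
  have hsmooth : ContDiff ℝ ∞ fun x => lyapunovComp ρ Φ c x - c :=
    (hρ.contDiff_comp hΦ hM').sub contDiff_const
  have hsupp : HasCompactSupport fun x => lyapunovComp ρ Φ c x - c :=
    HasCompactSupport.intro (hρ.isCompact_le M' (one_pos.trans_le (le_max_right _ _)))
      fun x hx => sub_eq_zero.2 (lyapunovComp_of_lt hM' (not_le.1 hx))
  obtain ⟨C, hC⟩ := hsupp.exists_bound_of_continuous hsmooth.continuous
  let f : E N →ᵇ ℝ := .ofNormedAddCommGroup _ hsmooth.continuous C hC
  refine ⟨f + BoundedContinuousFunction.const (E N) c, fun x => sub_add_cancel _ c, c, ?_⟩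
  rw [add_sub_cancel_right]
  exact ⟨hsmooth, hsupp⟩

theorem exists_reflStable_nhd {x : E N} (hx : ρ x ≠ ⊤) :
    ∃ W, IsOpen W ∧ ReflStable D W ∧ x ∈ W ∧ ∃ M : ℝ≥0, 0 < M ∧ ∀ y ∈ W, ρ y < M := by
  have hfin (g : activeGroup D) : ρ (g.1 x) ≠ ⊤ :=
    (ReflStable.map_mem_iff (V := {y | ρ y ≠ ⊤}) hρ.refl_ne_top g.2 x).2 hx
  obtain ⟨M, hM⟩ := Finite.exists_le fun g : activeGroup D => (ρ (g.1 x)).toNNReal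
  have horbit : ∀ g ∈ activeGroup D, ρ (g x) < (M + 1 : ℝ≥0) := fun g hg => by
    rw [← ENNReal.coe_toNNReal (hfin ⟨g, hg⟩), ENNReal.coe_lt_coe]
    exact (hM ⟨g, hg⟩).trans_lt (lt_add_one M)
  obtain ⟨W, hWU, hWo, hW, hxW⟩ := exists_reflStable_subset
    (isOpen_lt hρ.continuous continuous_const) horbit
  exact ⟨W, hWo, hW, hxW, M + 1, by positivity, hWU⟩

end IsLyapunov

namespace IsLyapunov

variable {D : RootData N} {b : E N → E N} {ρ : E N → ℝ≥0∞} (hρ : IsLyapunov D b ρ)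

section
include hρ

theorem exists_isTestAddConst_eq_comp_of_lt {ψ : ℝ → ℝ} (hψ : ContDiffOn ℝ ∞ ψ (Set.Ioi (-1)))
    (hψ_nonpos : ∀ r > -1, ψ r ≤ 0) {M : ℝ≥0} (hM : 0 < M) :
    ∃ h : E N →ᵇ ℝ, IsTestAddConst h ∧ (∀ x, h x ≤ 0) ∧ ∀ x, ρ x < M → h x = ψ (ρ x).toReal := by
  have hM' : (0 : ℝ) < M := hM
  have hχ : ContDiffOn ℝ ∞ (fun r => cutoff (r / M) * ψ r) (Set.Ioi (-1)) :=
    (contDiff_cutoff.comp (contDiff_id.div_const _)).contDiffOn.mul hψ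
  obtain ⟨h, h_eq, hh⟩ := hρ.exists_isTestAddConst_comp hχ (c := 0) (M := 2 * M) fun r hr => by
    rw [cutoff_of_two_le ((le_div_iff₀ hM').2 hr), zero_mul]
  refine ⟨h, hh, fun x => ?_, fun x hx => ?_⟩
  · rw [h_eq]
    by_cases htop : ρ x = ⊤
    · exact (lyapunovComp_of_eq_top htop _ 0).le
    · rw [lyapunovComp_of_ne_top htop]
      exact mul_nonpos_of_nonneg_of_nonpos (cutoff_nonneg _) (hψ_nonpos _ (neg_one_lt_toReal _))
  · have hle : (ρ x).toReal / M ≤ 1 := div_le_one_of_le₀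
      (ENNReal.toReal_le_of_le_ofReal hM'.le (by simpa using hx.le)) hM'.le
    rw [h_eq, lyapunovComp_of_ne_top hx.ne_top, cutoff_of_le_one hle, one_mul]

end

variable {S : MarkovSemigroup N} {Φ : ℝ → ℝ} {c : ℝ} {u : E N →ᵇ ℝ} (hS : S.IsGeneratedBy D b)
  (hΦ : IsConcaveProfile Φ c) (hu : ∀ x, u x = lyapunovComp ρ Φ c x)
include hρ hS hΦ hu

/-- By concavity `Φ ∘ ρ` lies below its tangent `Φ r₀ + Φ' r₀ (ρ - r₀)` at `r₀ = ρ x`, so the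
maximum principle at `x` replaces the chain rule. -/
theorem L_comp_le_deriv_mul {x : E N} (hx : x ∈ regular D) (hxρ : ρ x ≠ ⊤) :
    L D b u x ≤ deriv Φ (ρ x).toReal * L D b (fun y => (ρ y).toReal) x := by
  obtain ⟨W, hWo, hW, hxW, M, hM, hWM⟩ := hρ.exists_reflStable_nhd hxρ
  set r₀ := (ρ x).toReal
  let gap (r : ℝ) : ℝ := Φ r - deriv Φ r₀ * r - (Φ r₀ - deriv Φ r₀ * r₀)
  have hgap_smooth : ContDiffOn ℝ ∞ gap (Set.Ioi (-1)) :=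
    (hΦ.contDiffOn.sub (contDiff_const.mul contDiff_id).contDiffOn).sub contDiffOn_const
  have hgap_nonpos : ∀ r > -1, gap r ≤ 0 := fun r hr => by
    simp only [gap]
    linarith [hΦ.le_tangent (neg_one_lt_toReal (ρ x)) hr]
  obtain ⟨h, hh, h_nonpos, h_eq⟩ :=
    hρ.exists_isTestAddConst_eq_comp_of_lt hgap_smooth hgap_nonpos hM
  have hx_zero : h x = 0 := by simp [h_eq x (hWM x hxW), gap, r₀]
  have hLh : L D b h x ≤ 0 :=
    hS.L_nonpos_of_forall_le hh fun y => (h_nonpos y).trans_eq hx_zero.symm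
  have hWh : Set.EqOn h (fun y => (u - deriv Φ r₀ • fun y => (ρ y).toReal : E N → ℝ) y -
      (Φ r₀ - deriv Φ r₀ * r₀)) W := fun y hy => by
    simp [h_eq y (hWM y hy), hu, lyapunovComp_of_ne_top (hWM y hy).ne_top, gap]
  have hu_smooth : ContDiffOn ℝ 2 u (W ∩ regular D) := fun y hy => by
    rw [show (u : E N → ℝ) = lyapunovComp ρ Φ c from funext hu]
    exact ((hρ.contDiffAt_comp hΦ.contDiffOn c (hWM y hy.1).ne_top).of_le
      ENat.LEInfty.out).contDiffWithinAt
  have hρ_smooth : ContDiffOn ℝ 2 (deriv Φ r₀ • fun y => (ρ y).toReal) (W ∩ regular D) :=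
    contDiffOn_const.smul
      ((hρ.smooth.of_le ENat.LEInfty.out).mono fun y hy => (hWM y hy.1).ne_top)
  rw [L_congr hWo hW hWh b hxW, L_sub_const, L_sub (hWo.inter (isOpen_regular D))
    (hW.inter (reflStable_regular D)) Set.inter_subset_right hu_smooth hρ_smooth b ⟨hxW, hx⟩,
    L_const_smul] at hLh
  exact sub_nonpos.1 hLh

theorem L_comp_le {C₁ C₂ : ℝ}
    (hdrift : ∀ x, ρ x ≠ ⊤ → L D b (fun y => (ρ y).toReal) x ≤ C₁ - C₂ * (ρ x).toReal)
    {H : E N → ℝ} (hH : Continuous H)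
    (hle : ∀ x, ρ x ≠ ⊤ → deriv Φ (ρ x).toReal * (C₁ - C₂ * (ρ x).toReal) ≤ H x)
    (htop : ∀ x, ρ x = ⊤ → 0 ≤ H x) (huT : IsTestAddConst u) (x : E N) : L D b u x ≤ H x := by
  obtain ⟨l, -, hl⟩ := hS.exists_hasGenerator huT
  have hclosed : IsClosed {x | L D b u x ≤ H x} := by
    simpa only [← hl] using isClosed_le l.continuous hH
  by_cases hx : ρ x = ⊤
  · refine (hS.L_nonpos_of_forall_le huT fun y => ?_).trans (htop x hx)
    rw [hu, hu, lyapunovComp_of_eq_top hx]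
    by_cases hy : ρ y = ⊤
    · exact (lyapunovComp_of_eq_top hy Φ c).le
    · exact (lyapunovComp_of_ne_top hy Φ c).trans_le (hΦ.apply_le (neg_one_lt_toReal _))
  · refine hclosed.closure_subset_iff.2 (fun y hy => ?_)
      ((dense_regular D).open_subset_closure_inter hρ.isOpen_ne_top hx)
    have hderiv_nonneg : 0 ≤ deriv Φ (ρ y).toReal := hΦ.deriv_nonneg (neg_one_lt_toReal _)
    calc L D b u y ≤ deriv Φ (ρ y).toReal * L D b (fun y => (ρ y).toReal) y :=
          hρ.L_comp_le_deriv_mul hS hΦ hu hy.2 hy.1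
      _ ≤ deriv Φ (ρ y).toReal * (C₁ - C₂ * (ρ y).toReal) := by
          gcongr
          exact hdrift y hy.1
      _ ≤ H y := hle y hy.1

end IsLyapunov

theorem gronwallBound_neg_le_max {δ lam ε t : ℝ} (hlam : 0 < lam) (ht : 0 ≤ t) :
    gronwallBound δ (-lam) ε t ≤ max δ (ε / lam) := by
  have hexp : Real.exp (-lam * t) ≤ 1 := Real.exp_le_one_iff.2 (by nlinarith)
  calc gronwallBound δ (-lam) ε t
      = Real.exp (-lam * t) * δ + (1 - Real.exp (-lam * t)) * (ε / lam) := by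
        rw [gronwallBound_of_K_ne_0 (neg_ne_zero.2 hlam.ne')]
        ring
    _ ≤ Real.exp (-lam * t) * max δ (ε / lam) + (1 - Real.exp (-lam * t)) * max δ (ε / lam) :=
        add_le_add (mul_le_mul_of_nonneg_left (le_max_left _ _) (Real.exp_nonneg _))
          (mul_le_mul_of_nonneg_left (le_max_right _ _) (sub_nonneg.2 hexp))
    _ = max δ (ε / lam) := by ring

theorem isConcaveProfile_one_add {n : ℝ} (hn : 0 < n) :
    IsConcaveProfile (fun r => n * truncation ((1 + r) / n)) (n * truncation 2) :=
  isConcaveProfile_truncation (contDiff_const.add contDiff_id).contDiffOn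
    ((concaveOn_const 1 (convex_Ioi _)).add (concaveOn_id (convex_Ioi _)))
    (tendsto_atTop_add_const_left _ 1 tendsto_id) hn

theorem isConcaveProfile_sqrt {n : ℝ} (hn : 0 < n) :
    IsConcaveProfile (fun r => n * truncation (√(1 + r) / n)) (n * truncation 2) := by
  have hpos : ∀ r ∈ Set.Ioi (-1 : ℝ), 0 < 1 + r := fun r hr => by linarith [Set.mem_Ioi.1 hr]
  refine isConcaveProfile_truncation (φ := fun r => √(1 + r)) ?_ ?_
    (Real.tendsto_sqrt_atTop.comp (tendsto_atTop_add_const_left _ 1 tendsto_id)) hn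
  · exact (contDiff_const.add contDiff_id).contDiffOn.sqrt fun r hr => (hpos r hr).ne'
  · refine ⟨convex_Ioi _, fun r hr s hs a b ha hb hab => ?_⟩
    have hconcave := Real.strictConcaveOn_sqrt.concaveOn.2 (hpos r hr).le (hpos s hs).le ha hb hab
    simp only [smul_eq_mul] at hconcave ⊢
    convert hconcave using 2
    linear_combination -hab

theorem hasDerivAt_truncation_comp {φ : ℝ → ℝ} {φ' n r : ℝ} (hφ : HasDerivAt φ φ' r)
    (hn : n ≠ 0) :
    HasDerivAt (fun r => n * truncation (φ r / n)) (cutoff (φ r / n) * φ') r := by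
  have h := ((hasDerivAt_truncation (φ r / n)).comp r (hφ.div_const n)).const_mul n
  rwa [mul_div_assoc', mul_div_cancel₀ _ hn] at h

theorem min_le_mul_truncation {n : ℝ} (hn : 0 < n) (a : ℝ) :
    min a n ≤ n * truncation (a / n) := by
  calc min a n = n * min (a / n) 1 := by
        rw [mul_min_of_nonneg _ _ hn.le, mul_div_cancel₀ _ hn.ne', mul_one]
    _ ≤ n * truncation (a / n) := by gcongr; exact min_one_le_truncation _

theorem mul_truncation_le_self {n : ℝ} (hn : 0 < n) (a : ℝ) : n * truncation (a / n) ≤ a :=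
  (mul_le_mul_of_nonneg_left (truncation_le_self _) hn.le).trans_eq (mul_div_cancel₀ _ hn.ne')

theorem mul_inv_sqrt_mul_le {C₁ C₂ c s : ℝ} (hC₁ : 0 ≤ C₁) (hC₂ : 0 ≤ C₂) (hc : c ≤ 1)
    (hs : 1 ≤ s) :
    c * (1 / (2 * s)) * (C₁ - C₂ * (s ^ 2 - 1)) ≤ (C₁ + C₂) / 2 - C₂ / 2 * (c * s) := by
  have hs_pos : 0 < s := one_pos.trans_le hs
  have hdiv_le : c / s ≤ 1 := div_le_one_of_le₀ (hc.trans hs) hs_pos.le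
  calc c * (1 / (2 * s)) * (C₁ - C₂ * (s ^ 2 - 1))
      = c / s * ((C₁ + C₂) / 2) - C₂ / 2 * (c * s) := by field_simp; ring
    _ ≤ (C₁ + C₂) / 2 - C₂ / 2 * (c * s) :=
      sub_le_sub_right (mul_le_of_le_one_left (by positivity) hdiv_le) _

/-- Where `√(1 + r) ≤ n` nothing is truncated; beyond that the `v`-term pays for the truncation. -/
theorem mul_truncation_div_le {n s v : ℝ} (hn : 0 < n) (hs : 0 ≤ s) (hv : min (s ^ 2) (n ^ 2) ≤ v) :
    n * truncation (s / n) ≤ truncation 2 / n * v + cutoff (s / n) * s := by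
  have htwo : 0 < truncation 2 := one_pos.trans_le one_le_truncation_two
  rcases le_total s n with hsn | hns
  · have hv_nonneg : 0 ≤ v := (le_min (sq_nonneg s) (sq_nonneg n)).trans hv
    rw [cutoff_of_le_one ((div_le_one hn).2 hsn), one_mul]
    exact (mul_truncation_le_self hn s).trans (le_add_of_nonneg_left (by positivity))
  · have hnv : n ^ 2 ≤ v := by
      rwa [min_eq_right (pow_le_pow_left₀ hn.le hns 2)] at hv
    calc n * truncation (s / n) ≤ n * truncation 2 := by
          gcongr; exact truncation_le_truncation_two _
      _ = truncation 2 / n * n ^ 2 := by field_simp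
      _ ≤ truncation 2 / n * v := by gcongr
      _ ≤ _ := le_add_of_nonneg_right (mul_nonneg (cutoff_nonneg _) hs)

theorem deriv_truncation_sqrt_mul_le {C₁ C₂ n r v : ℝ} (hC₁ : 0 ≤ C₁) (hC₂ : 0 ≤ C₂) (hn : 0 < n)
    (hr : 0 ≤ r) (hv : min (1 + r) (n ^ 2) ≤ v) :
    deriv (fun r => n * truncation (√(1 + r) / n)) r * (C₁ - C₂ * r) ≤
      (C₁ + C₂) / 2 + C₂ / 2 * (truncation 2 / n * v)
        - C₂ / 2 * (n * truncation (√(1 + r) / n)) := by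
  have hr_pos : 0 < 1 + r := by linarith
  have hs_sq : √(1 + r) ^ 2 = 1 + r := Real.sq_sqrt hr_pos.le
  have hderiv : HasDerivAt (fun r => √(1 + r)) (1 / (2 * √(1 + r))) r :=
    ((hasDerivAt_id' r).const_add 1).sqrt hr_pos.ne'
  have hdrift := mul_inv_sqrt_mul_le hC₁ hC₂ (cutoff_le_one (√(1 + r) / n))
    (Real.one_le_sqrt.2 (le_add_of_nonneg_right hr))
  rw [hs_sq, add_sub_cancel_left] at hdrift
  have htrunc := mul_truncation_div_le hn (Real.sqrt_nonneg (1 + r)) (hs_sq.symm ▸ hv)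
  rw [(hasDerivAt_truncation_comp hderiv hn.ne').deriv]
  linear_combination hdrift + C₂ / 2 * htrunc

namespace IsLyapunov

variable {D : RootData N} {b : E N → E N} {ρ : E N → ℝ≥0∞}

theorem le_lyapunovComp_truncation {φ : ℝ → ℝ} {n : ℝ} (hn : 0 < n) {f : E N →ᵇ ℝ}
    (hfn : ‖f‖ ≤ n) (hf : ∀ y, ρ y ≠ ⊤ → f y ≤ φ (ρ y).toReal) (y : E N) :
    f y ≤ lyapunovComp ρ (fun r => n * truncation (φ r / n)) (n * truncation 2) y := by
  have hy_le : f y ≤ n := (le_abs_self _).trans ((f.norm_coe_le_norm y).trans hfn)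
  by_cases hy : ρ y = ⊤
  · rw [lyapunovComp_of_eq_top hy]
    exact hy_le.trans (le_mul_of_one_le_right hn.le one_le_truncation_two)
  · rw [lyapunovComp_of_ne_top hy]
    exact (le_min (hf y hy) hy_le).trans (min_le_mul_truncation hn _)

theorem exists_isTestAddConst_profile (hρ : IsLyapunov D b ρ) {Φ : ℝ → ℝ} {c : ℝ}
    (hΦ : IsConcaveProfile Φ c) :
    ∃ u : E N →ᵇ ℝ, (∀ x, u x = lyapunovComp ρ Φ c x) ∧ IsTestAddConst u :=
  let ⟨_, hM⟩ := hΦ.eq_of_ge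
  hρ.exists_isTestAddConst_comp hΦ.contDiffOn hM

variable {S : MarkovSemigroup N} (hρ : IsLyapunov D b ρ) (hS : S.IsGeneratedBy D b) {C₁ C₂ : ℝ}
  (hC₁ : 0 ≤ C₁) (hC₂ : 0 < C₂)
  (hdrift : ∀ x, ρ x ≠ ⊤ → L D b (fun y => (ρ y).toReal) x ≤ C₁ - C₂ * (ρ x).toReal)
include hρ hS hC₁ hC₂ hdrift

theorem P_apply_le_add_mul {f : E N →ᵇ ℝ} (hf : ∀ y, ρ y ≠ ⊤ → f y ≤ 1 + (ρ y).toReal)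
    {x : E N} (hx : ρ x ≠ ⊤) (t : ℝ≥0) : S.P t f x ≤ 1 + (ρ x).toReal + C₁ * t := by
  have hn : (0 : ℝ) < max 1 ‖f‖ := one_pos.trans_le (le_max_left _ _)
  set n := max 1 ‖f‖
  have hΦ := isConcaveProfile_one_add hn
  obtain ⟨u, hu, huT⟩ := hρ.exists_isTestAddConst_profile hΦ
  have hfu : ∀ y, f y ≤ u y := fun y => by
    rw [hu]
    exact le_lyapunovComp_truncation hn (le_max_right _ _) hf y
  have hux : u x ≤ 1 + (ρ x).toReal := by
    rw [hu, lyapunovComp_of_ne_top hx]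
    exact mul_truncation_le_self hn _
  have hL : ∀ y, L D b u y ≤ BoundedContinuousFunction.const (E N) C₁ y := by
    refine hρ.L_comp_le hS hΦ hu hdrift (BoundedContinuousFunction.continuous _) (fun y _ => ?_)
      (fun _ _ => hC₁) huT
    rw [(hasDerivAt_truncation_comp ((hasDerivAt_id' _).const_add 1) hn.ne').deriv, mul_one]
    refine (mul_le_mul_of_nonneg_left (sub_le_self C₁ ?_) (cutoff_nonneg _)).trans
      (mul_le_of_le_one_left hC₁ (cutoff_le_one _))
    exact mul_nonneg hC₂.le ENNReal.toReal_nonneg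
  calc S.P t f x ≤ S.P t u x := S.mono t hfu x
    _ ≤ gronwallBound (u x) 0 C₁ t :=
      hS.P_apply_le_gronwallBound huT hL fun s _ => by simp [S.P_const]
    _ = u x + C₁ * t := by rw [gronwallBound_K0]
    _ ≤ 1 + (ρ x).toReal + C₁ * t := by gcongr

theorem L_truncation_sqrt_le {n : ℝ} (hn : 0 < n) {u v : E N →ᵇ ℝ}
    (hu : ∀ y, u y = lyapunovComp ρ (fun r => n * truncation (√(1 + r) / n)) (n * truncation 2) y)
    (huT : IsTestAddConst u)
    (hv : ∀ y, v y =
      lyapunovComp ρ (fun r => n ^ 2 * truncation ((1 + r) / n ^ 2)) (n ^ 2 * truncation 2) y)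
    (x : E N) :
    L D b u x ≤ (C₁ + C₂) / 2 + C₂ / 2 * (truncation 2 / n * v x) - C₂ / 2 * u x := by
  refine hρ.L_comp_le hS (isConcaveProfile_sqrt hn) hu hdrift
    (H := fun y => (C₁ + C₂) / 2 + C₂ / 2 * (truncation 2 / n * v y) - C₂ / 2 * u y)
    (by fun_prop) (fun y hy => ?_) (fun y hy => ?_) huT x
  · rw [hu, hv, lyapunovComp_of_ne_top hy, lyapunovComp_of_ne_top hy]
    exact deriv_truncation_sqrt_mul_le hC₁ hC₂.le hn ENNReal.toReal_nonneg
      (min_le_mul_truncation (pow_pos hn 2) _)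
  · have htwo : 0 ≤ truncation 2 := zero_le_one.trans one_le_truncation_two
    have hle : n * truncation 2 ≤ truncation 2 / n * (n ^ 2 * truncation 2) := by
      rw [show truncation 2 / n * (n ^ 2 * truncation 2) = n * truncation 2 * truncation 2 by
        field_simp]
      exact le_mul_of_one_le_right (by positivity) one_le_truncation_two
    rw [hu, hv, lyapunovComp_of_eq_top hy, lyapunovComp_of_eq_top hy]
    linear_combination C₂ / 2 * hle + hC₁ / 2 + hC₂ / 2

theorem P_truncation_sqrt_le_max {n : ℝ} (hn : 0 < n) {u v : E N →ᵇ ℝ}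
    (hu : ∀ y, u y = lyapunovComp ρ (fun r => n * truncation (√(1 + r) / n)) (n * truncation 2) y)
    (huT : IsTestAddConst u)
    (hv : ∀ y, v y =
      lyapunovComp ρ (fun r => n ^ 2 * truncation ((1 + r) / n ^ 2)) (n ^ 2 * truncation 2) y)
    {x : E N} {t : ℝ≥0} (hPv : ∀ s ≤ t, S.P s v x ≤ n) :
    S.P t u x ≤ max (u x) ((C₁ + C₂) / C₂ + truncation 2) := by
  let H : E N →ᵇ ℝ := BoundedContinuousFunction.const (E N) ((C₁ + C₂) / 2) +
    (C₂ / 2 * (truncation 2 / n)) • v - (C₂ / 2) • u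
  have hL : ∀ y, L D b u y ≤ H y := fun y => by
    simpa [H, mul_assoc] using hρ.L_truncation_sqrt_le hS hC₁ hC₂ hdrift hn hu huT hv y
  have hPH : ∀ s ≤ t, S.P s H x ≤ -(C₂ / 2) * S.P s u x +
      ((C₁ + C₂) / 2 + C₂ / 2 * truncation 2) := fun s hs => by
    have htwo : 0 ≤ truncation 2 := zero_le_one.trans one_le_truncation_two
    have hPv_mul : truncation 2 / n * S.P s v x ≤ truncation 2 :=
      (mul_le_mul_of_nonneg_left (hPv s hs) (by positivity)).trans_eq (div_mul_cancel₀ _ hn.ne')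
    have hPH_eq : S.P s H x = (C₁ + C₂) / 2 + C₂ / 2 * (truncation 2 / n * S.P s v x)
        - C₂ / 2 * S.P s u x := by
      simp [H, S.P_const, mul_assoc]
    rw [hPH_eq]
    linear_combination C₂ / 2 * hPv_mul
  calc S.P t u x
      ≤ gronwallBound (u x) (-(C₂ / 2)) ((C₁ + C₂) / 2 + C₂ / 2 * truncation 2) t :=
      hS.P_apply_le_gronwallBound huT hL hPH
    _ ≤ max (u x) (((C₁ + C₂) / 2 + C₂ / 2 * truncation 2) / (C₂ / 2)) :=
      gronwallBound_neg_le_max (half_pos hC₂) t.2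
    _ = max (u x) ((C₁ + C₂) / C₂ + truncation 2) := by
      congr 1
      field_simp

theorem P_apply_le_max {f : E N →ᵇ ℝ} (hf : ∀ y, ρ y ≠ ⊤ → f y ≤ √(1 + (ρ y).toReal))
    {x : E N} (hx : ρ x ≠ ⊤) (t : ℝ≥0) :
    S.P t f x ≤ max √(1 + (ρ x).toReal) ((C₁ + C₂) / C₂ + truncation 2) := by
  have hn : (0 : ℝ) < max ‖f‖ (1 + (ρ x).toReal + C₁ * t) :=
    lt_max_of_lt_right (by positivity)
  set n := max ‖f‖ (1 + (ρ x).toReal + C₁ * t)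
  obtain ⟨v, hv, -⟩ := hρ.exists_isTestAddConst_profile (isConcaveProfile_one_add (pow_pos hn 2))
  obtain ⟨u, hu, huT⟩ := hρ.exists_isTestAddConst_profile (isConcaveProfile_sqrt hn)
  have hv_le : ∀ y, ρ y ≠ ⊤ → v y ≤ 1 + (ρ y).toReal := fun y hy => by
    rw [hv, lyapunovComp_of_ne_top hy]
    exact mul_truncation_le_self (pow_pos hn 2) _
  have hux : u x ≤ √(1 + (ρ x).toReal) := by
    rw [hu, lyapunovComp_of_ne_top hx]
    exact mul_truncation_le_self hn _
  have hfu : ∀ y, f y ≤ u y := fun y => by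
    rw [hu]
    exact le_lyapunovComp_truncation hn (le_max_left _ _) hf y
  have hPv : ∀ s ≤ t, S.P s v x ≤ n := fun s hs => by
    calc S.P s v x ≤ 1 + (ρ x).toReal + C₁ * s :=
          hρ.P_apply_le_add_mul hS hC₁ hC₂ hdrift hv_le hx s
      _ ≤ 1 + (ρ x).toReal + C₁ * t := by gcongr
      _ ≤ n := le_max_right _ _
  calc S.P t f x ≤ S.P t u x := S.mono t hfu x
    _ ≤ max (u x) ((C₁ + C₂) / C₂ + truncation 2) :=
      hρ.P_truncation_sqrt_le_max hS hC₁ hC₂ hdrift hn hu huT hv hPv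
    _ ≤ _ := max_le_max_right _ hux

end IsLyapunov

/-! ### Tight functionals -/

section Tight

open scoped CompactlySupported

variable {X : Type*} [TopologicalSpace X] {ι : Type*}

/-- A family of functionals on `C_b(X)` is tight if its members are uniformly small on the
functions of a norm ball that are small on a large compact set. For integrals against probability
measures this is tightness of the measures. -/
def IsTightFamily (Λ : ι → (X →ᵇ ℝ) → ℝ) : Prop :=
  ∀ B : ℝ, ∀ ε > 0, ∃ K : Set X, IsCompact K ∧ ∃ δ > 0, ∀ w : X →ᵇ ℝ, ‖w‖ ≤ B →
    (∀ y ∈ K, |w y| ≤ δ) → ∀ i, |Λ i w| ≤ ε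

namespace IsTightFamily

variable {Λ Λ' : ι → (X →ᵇ ℝ) → ℝ}

theorem comp {κ : Type*} (hΛ : IsTightFamily Λ) (e : κ → ι) : IsTightFamily fun k => Λ (e k) := by
  intro B ε hε
  obtain ⟨K, hK, δ, hδ, h⟩ := hΛ B ε hε
  exact ⟨K, hK, δ, hδ, fun w hw hwK k => h w hw hwK (e k)⟩

theorem sub (hΛ : IsTightFamily Λ) (hΛ' : IsTightFamily Λ') :
    IsTightFamily fun i f => Λ i f - Λ' i f := by
  intro B ε hε
  obtain ⟨K, hK, δ, hδ, h⟩ := hΛ B (ε / 2) (half_pos hε)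
  obtain ⟨K', hK', δ', hδ', h'⟩ := hΛ' B (ε / 2) (half_pos hε)
  refine ⟨K ∪ K', hK.union hK', min δ δ', lt_min hδ hδ', fun w hw hwK i => ?_⟩
  have hi := h w hw (fun y hy => (hwK y (.inl hy)).trans (min_le_left _ _)) i
  have hi' := h' w hw (fun y hy => (hwK y (.inr hy)).trans (min_le_right _ _)) i
  exact (abs_sub _ _).trans ((add_le_add hi hi').trans_eq (add_halves ε))

theorem of_tendsto (hΛ : IsTightFamily Λ) {l : Filter ι} [l.NeBot] {Λ₀ : (X →ᵇ ℝ) → ℝ}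
    (h : ∀ f, Tendsto (fun i => Λ i f) l (𝓝 (Λ₀ f))) : IsTightFamily fun _ : Unit => Λ₀ := by
  intro B ε hε
  obtain ⟨K, hK, δ, hδ, hle⟩ := hΛ B ε hε
  exact ⟨K, hK, δ, hδ, fun w hw hwK _ => le_of_tendsto' (h w).abs (hle w hw hwK)⟩

end IsTightFamily

theorem norm_mul_one_sub_le (f : X →ᵇ ℝ) {χ : X →ᵇ ℝ} (hχ : ∀ x, χ x ∈ Set.Icc 0 1) :
    ‖f * (1 - χ)‖ ≤ ‖f‖ := by
  refine (norm_mul_le _ _).trans (mul_le_of_le_one_right (norm_nonneg f) ?_)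
  refine (BoundedContinuousFunction.norm_le zero_le_one).2 fun x => abs_le.2 ?_
  obtain ⟨hχ_nonneg, hχ_le⟩ := hχ x
  rw [BoundedContinuousFunction.coe_sub, Pi.sub_apply, BoundedContinuousFunction.coe_one,
    Pi.one_apply]
  exact ⟨by linarith, by linarith⟩

theorem abs_integral_mul_one_sub_le [MeasurableSpace X] [OpensMeasurableSpace X]
    (ν : Measure X) [IsFiniteMeasure ν] (f : X →ᵇ ℝ) {χ : X →ᵇ ℝ} (hχ : ∀ x, χ x ≤ 1) :
    |∫ x, f x * (1 - χ x) ∂ν| ≤ ‖f‖ * (ν.real Set.univ - ∫ x, χ x ∂ν) := by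
  have hint : Integrable (fun x => ‖f‖ * (1 - χ x)) ν :=
    ((integrable_const 1).sub (χ.integrable ν)).const_mul _
  have hle (x : X) : ‖f x * (1 - χ x)‖ ≤ ‖f‖ * (1 - χ x) := by
    rw [norm_mul, Real.norm_of_nonneg (sub_nonneg.2 (hχ x))]
    exact mul_le_mul_of_nonneg_right (f.norm_coe_le_norm x) (sub_nonneg.2 (hχ x))
  calc |∫ x, f x * (1 - χ x) ∂ν| ≤ ∫ x, ‖f‖ * (1 - χ x) ∂ν :=
        norm_integral_le_of_norm_le hint (.of_forall hle)
    _ = ‖f‖ * (ν.real Set.univ - ∫ x, χ x ∂ν) := by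
        rw [integral_const_mul, integral_sub (integrable_const 1) (χ.integrable ν),
          integral_const, smul_eq_mul, mul_one]

variable [T2Space X] [LocallyCompactSpace X]

theorem exists_compactlySupported_eq_one {K : Set X} (hK : IsCompact K) :
    ∃ χ : C_c(X, ℝ), (∀ x ∈ K, χ x = 1) ∧ ∀ x, χ x ∈ Set.Icc 0 1 := by
  obtain ⟨χ, hχK, -, hχ_supp, hχ⟩ := exists_continuous_one_zero_of_isCompact hK isClosed_empty
    (Set.disjoint_empty K)
  exact ⟨⟨χ, hχ_supp⟩, hχK, hχ⟩

/-- The restriction to `C_c(X)` of a positive functional on `C_b(X)`. -/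
def restrictCompactlySupported (Λ : (X →ᵇ ℝ) →ₚ[ℝ] ℝ) : C_c(X, ℝ) →ₚ[ℝ] ℝ :=
  PositiveLinearMap.mk₀
    { toFun := fun f => Λ f.toBoundedContinuousFunction
      map_add' := fun f g => map_add Λ f.toBoundedContinuousFunction g.toBoundedContinuousFunction
      map_smul' := fun c f => map_smul Λ c f.toBoundedContinuousFunction }
    fun _ hf => Λ.map_nonneg hf

variable [MeasurableSpace X] [BorelSpace X]

theorem rieszMeasure_univ_le_one {Λ : (X →ᵇ ℝ) →ₚ[ℝ] ℝ} (hone : Λ 1 = 1) :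
    RealRMK.rieszMeasure (restrictCompactlySupported Λ) Set.univ ≤ 1 := by
  rw [isOpen_univ.measure_eq_iSup_isCompact]
  refine iSup₂_le fun K _ => iSup_le fun hK => ?_
  obtain ⟨χ, hχK, hχ⟩ := exists_compactlySupported_eq_one hK
  refine (RealRMK.rieszMeasure_le_of_eq_one _ (fun x => (hχ x).1) hK hχK).trans ?_
  rw [← ENNReal.ofReal_one, ← hone]
  exact ENNReal.ofReal_le_ofReal (OrderHomClass.mono Λ fun x => (hχ x).2)

theorem apply_sub_integral_eq {Λ : (X →ᵇ ℝ) →ₚ[ℝ] ℝ} (hone : Λ 1 = 1) (f : X →ᵇ ℝ)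
    (χ : C_c(X, ℝ)) :
    Λ f - ∫ x, f x ∂(RealRMK.rieszMeasure (restrictCompactlySupported Λ)) =
      Λ (f * (1 - χ.toBoundedContinuousFunction)) -
        ∫ x, f x * (1 - χ x) ∂(RealRMK.rieszMeasure (restrictCompactlySupported Λ)) := by
  set ν := RealRMK.rieszMeasure (restrictCompactlySupported Λ)
  have hfin : IsFiniteMeasure ν := ⟨(rieszMeasure_univ_le_one hone).trans_lt ENNReal.one_lt_top⟩
  let χb := χ.toBoundedContinuousFunction
  let fχ : C_c(X, ℝ) := ⟨⟨fun x => f x * χ x, by fun_prop⟩, χ.hasCompactSupport.mul_left⟩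
  have hsplit (x : X) : f x = fχ x + f x * (1 - χ x) := by
    change f x = f x * χ x + f x * (1 - χ x)
    ring
  have hΛ : Λ f = ∫ x, fχ x ∂ν + Λ (f * (1 - χb)) := by
    rw [RealRMK.integral_rieszMeasure]
    change Λ f = Λ fχ.toBoundedContinuousFunction + Λ (f * (1 - χb))
    rw [← map_add]
    exact congrArg Λ (BoundedContinuousFunction.ext hsplit)
  have hν : ∫ x, f x ∂ν = ∫ x, fχ x ∂ν + ∫ x, f x * (1 - χ x) ∂ν :=
    (integral_congr_ae (.of_forall hsplit)).trans
      (integral_add (fχ.toBoundedContinuousFunction.integrable ν) ((f * (1 - χb)).integrable ν))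
  rw [hΛ, hν, add_sub_add_left_eq_sub]

theorem abs_apply_sub_integral_le {Λ : (X →ᵇ ℝ) →ₚ[ℝ] ℝ} (hone : Λ 1 = 1) (f : X →ᵇ ℝ)
    {χ : C_c(X, ℝ)} (hχ : ∀ x, χ x ∈ Set.Icc 0 1) :
    |Λ f - ∫ x, f x ∂(RealRMK.rieszMeasure (restrictCompactlySupported Λ))| ≤
      |Λ (f * (1 - χ.toBoundedContinuousFunction))| +
        ‖f‖ * Λ (1 - χ.toBoundedContinuousFunction) := by
  have hle := rieszMeasure_univ_le_one hone
  have hint := RealRMK.integral_rieszMeasure (restrictCompactlySupported Λ) χ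
  set ν := RealRMK.rieszMeasure (restrictCompactlySupported Λ)
  have hfin : IsFiniteMeasure ν := ⟨hle.trans_lt ENNReal.one_lt_top⟩
  have hmass : ν.real Set.univ ≤ 1 :=
    ENNReal.toReal_le_of_le_ofReal zero_le_one (hle.trans_eq ENNReal.ofReal_one.symm)
  rw [apply_sub_integral_eq hone f χ]
  refine (abs_sub _ _).trans (add_le_add_right ?_ _)
  calc |∫ x, f x * (1 - χ x) ∂ν| ≤ ‖f‖ * (ν.real Set.univ - ∫ x, χ x ∂ν) :=
        abs_integral_mul_one_sub_le ν f (χ := χ.toBoundedContinuousFunction) fun x => (hχ x).2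
    _ ≤ ‖f‖ * (1 - ∫ x, χ x ∂ν) := by gcongr
    _ = ‖f‖ * Λ (1 - χ.toBoundedContinuousFunction) := by
        rw [map_sub, hone, hint]
        rfl

theorem IsTightFamily.apply_eq_integral_rieszMeasure {Λ : (X →ᵇ ℝ) →ₚ[ℝ] ℝ}
    (hΛ : IsTightFamily fun _ : Unit => (Λ : (X →ᵇ ℝ) → ℝ)) (hone : Λ 1 = 1) (f : X →ᵇ ℝ) :
    Λ f = ∫ x, f x ∂(RealRMK.rieszMeasure (restrictCompactlySupported Λ)) := by
  refine eq_of_forall_dist_le fun ε hε => ?_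
  obtain ⟨K, hK, δ, hδ, hsmall⟩ := hΛ (max ‖f‖ 1) (ε / (1 + ‖f‖)) (by positivity)
  obtain ⟨χ, hχK, hχ⟩ := exists_compactlySupported_eq_one hK
  have hle (g : X →ᵇ ℝ) (hg : ‖g‖ ≤ max ‖f‖ 1) :
      |Λ (g * (1 - χ.toBoundedContinuousFunction))| ≤ ε / (1 + ‖f‖) :=
    hsmall _ ((norm_mul_one_sub_le g hχ).trans hg)
      (fun y hy => by simp [hχK y hy, hδ.le]) ()
  calc |Λ f - ∫ x, f x ∂(RealRMK.rieszMeasure (restrictCompactlySupported Λ))|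
      ≤ ε / (1 + ‖f‖) + ‖f‖ * (ε / (1 + ‖f‖)) := by
        refine (abs_apply_sub_integral_le hone f hχ).trans ?_
        gcongr
        · exact hle f (le_max_left _ _)
        · have hone_le : ‖(1 : X →ᵇ ℝ)‖ ≤ 1 :=
            (BoundedContinuousFunction.norm_le zero_le_one).2 fun x => by simp
          simpa using (le_abs_self _).trans (hle 1 (hone_le.trans (le_max_right _ _)))
    _ = ε := by field_simp

theorem IsTightFamily.exists_isProbabilityMeasure {Λ : (X →ᵇ ℝ) →ₚ[ℝ] ℝ}
    (hΛ : IsTightFamily fun _ : Unit => (Λ : (X →ᵇ ℝ) → ℝ)) (hone : Λ 1 = 1) :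
    ∃ ν : Measure X, IsProbabilityMeasure ν ∧ ∀ f, Λ f = ∫ x, f x ∂ν := by
  have hrep := hΛ.apply_eq_integral_rieszMeasure hone
  refine ⟨_, ⟨?_⟩, hrep⟩
  have hmass := hrep 1
  simp only [hone, BoundedContinuousFunction.coe_one, Pi.one_apply, integral_const, smul_eq_mul,
    mul_one] at hmass
  rw [← ENNReal.ofReal_one, hmass, ofReal_measureReal
    ((rieszMeasure_univ_le_one hone).trans_lt ENNReal.one_lt_top).ne]

end Tight

/-- Tightness of the family `f ↦ P_t f x`, `t ≥ 0`: no mass started at `x` escapes to infinity. -/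
def MarkovSemigroup.IsTightAt (S : MarkovSemigroup N) (x : E N) : Prop :=
  IsTightFamily fun (t : ℝ≥0) (f : E N →ᵇ ℝ) => S.P t f x

namespace IsLyapunov

variable {D : RootData N} {b : E N → E N} {ρ : E N → ℝ≥0∞} {S : MarkovSemigroup N}

theorem exists_P_apply_le_add_div (hρ : IsLyapunov D b ρ) (hS : S.IsGeneratedBy D b) {x : E N}
    (hx : ρ x ≠ ⊤) :
    ∃ A : ℝ, ∀ (t : ℝ≥0) (w : E N →ᵇ ℝ) {d q δ : ℝ}, 0 < d → 0 < q → 0 ≤ δ → ‖w‖ ≤ d →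
      (∀ y, ρ y ≤ ENNReal.ofReal (q ^ 2 - 1) → w y ≤ δ) → S.P t w x ≤ δ + d * A / q := by
  obtain ⟨C₁, C₂, hC₁, hC₂, hdrift⟩ := hρ.drift
  refine ⟨max √(1 + (ρ x).toReal) ((C₁ + C₂) / C₂ + truncation 2),
    fun t w {d q δ} hd hq hδ hwd hw => ?_⟩
  let f : E N →ᵇ ℝ := (q / d) • (w - BoundedContinuousFunction.const (E N) δ)
  have hf_apply : ∀ y, f y = q / d * (w y - δ) := fun y => rfl
  have hf : ∀ y, ρ y ≠ ⊤ → f y ≤ √(1 + (ρ y).toReal) := fun y hy => by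
    rw [hf_apply]
    by_cases hyq : ρ y ≤ ENNReal.ofReal (q ^ 2 - 1)
    · exact (mul_nonpos_of_nonneg_of_nonpos (by positivity) (sub_nonpos.2 (hw y hyq))).trans
        (Real.sqrt_nonneg _)
    · have hlt : q ^ 2 - 1 < (ρ y).toReal := lt_of_not_ge fun h =>
        hyq ((ENNReal.le_ofReal_iff_toReal_le hy (ENNReal.toReal_nonneg.trans h)).2 h)
      have hwy : w y - δ ≤ d := (sub_le_self _ hδ).trans
        ((le_abs_self _).trans ((w.norm_coe_le_norm y).trans hwd))
      calc q / d * (w y - δ) ≤ q / d * d := by gcongr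
        _ = q := div_mul_cancel₀ q hd.ne'
        _ ≤ √(1 + (ρ y).toReal) := Real.le_sqrt_of_sq_le (by linarith)
  have hPf := hρ.P_apply_le_max hS hC₁ hC₂ hdrift hf hx t
  have hPf_apply : S.P t f x = (S.P t w x - δ) * q / d := by
    simp only [f, map_smul, map_sub, S.P_const, BoundedContinuousFunction.coe_smul,
      BoundedContinuousFunction.coe_sub, Pi.sub_apply, BoundedContinuousFunction.const_apply,
      smul_eq_mul]
    ring
  rw [hPf_apply, div_le_iff₀ hd, ← le_div_iff₀ hq, sub_le_iff_le_add', mul_comm _ d] at hPf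
  exact hPf

theorem isTightAt (hρ : IsLyapunov D b ρ) (hS : S.IsGeneratedBy D b) {x : E N} (hx : ρ x ≠ ⊤) :
    S.IsTightAt x := by
  obtain ⟨A, hle⟩ := hρ.exists_P_apply_le_add_div hS hx
  intro B ε hε
  have hlim : Tendsto (fun q : ℝ => max B 1 * A / q) atTop (𝓝 0) :=
    tendsto_const_nhds.div_atTop tendsto_id
  obtain ⟨q, hqε, hq⟩ :=
    ((hlim.eventually_le_const (half_pos hε)).and (eventually_gt_atTop 1)).exists
  have hq_pos : 0 < q := one_pos.trans hq
  have hd : (0 : ℝ) < max B 1 := lt_max_of_lt_right one_pos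
  have hM : 0 < (q ^ 2 - 1).toNNReal := Real.toNNReal_pos.2 (by nlinarith)
  refine ⟨_, hρ.isCompact_le _ hM, ε / 2, half_pos hε, fun w hwB hwK t => ?_⟩
  have hwd : ‖w‖ ≤ max B 1 := hwB.trans (le_max_left _ _)
  have hpos := hle t w hd hq_pos (half_pos hε).le hwd
    fun y hy => (abs_le.1 (hwK y hy)).2
  have hneg := hle t (-w) hd hq_pos (half_pos hε).le ((norm_neg w).trans_le hwd)
    fun y hy => neg_le.1 (abs_le.1 (hwK y hy)).1
  rw [map_neg, BoundedContinuousFunction.coe_neg, Pi.neg_apply] at hneg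
  exact abs_le'.2 ⟨by linarith, by linarith⟩

end IsLyapunov

/-! ### Gradient estimate -/

theorem abs_diffQuot_le {α : E N} (hα : ‖α‖ ^ 2 = 2) {f : E N → ℝ} (hf : Differentiable ℝ f)
    {r C : ℝ} (hC : ∀ y ∈ Metric.closedBall (0 : E N) r, ‖fderiv ℝ f y‖ ≤ C) {x : E N}
    (hx : x ∈ Metric.closedBall (0 : E N) r) : |diffQuot α f x| ≤ C * ‖α‖ := by
  by_cases h0 : inner ℝ α x = 0
  · rw [diffQuot, if_pos h0]
    exact ContinuousLinearMap.le_of_opNorm_le _ (hC x hx) α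
  · rw [diffQuot, if_neg h0, abs_div, div_le_iff₀ (abs_pos.2 h0)]
    have hrefl : refl α x ∈ Metric.closedBall (0 : E N) r := by simpa using hx
    calc |f x - f (refl α x)| ≤ C * ‖x - refl α x‖ :=
          (convex_closedBall 0 r).norm_image_sub_le_of_norm_fderiv_le (fun y _ => hf y) hC hrefl hx
      _ = C * ‖α‖ * |inner ℝ α x| := by
          rw [sub_refl_apply hα, norm_smul, Real.norm_eq_abs]
          ring

theorem fderiv_apply_eq_sum_T (D : RootData N) (f : E N → ℝ) (x v : E N) :
    fderiv ℝ f x v = ∑ i, v i * T D i f x -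
      ∑ α ∈ D.Rplus, D.k α * inner ℝ α v * diffQuot α f x := by
  have hv : v = ∑ i, v i • EuclideanSpace.single i (1 : ℝ) := by
    simpa using ((EuclideanSpace.basisFun (Fin N) ℝ).sum_repr v).symm
  have hfderiv : fderiv ℝ f x v = ∑ i, v i * fderiv ℝ f x (EuclideanSpace.single i 1) := by
    conv_lhs => rw [hv, map_sum]
    simp only [map_smul, smul_eq_mul]
  have hinner (α : E N) : inner ℝ α v = ∑ i, v i * α i := by
    simp [PiLp.inner_apply]
  have hroots : ∑ α ∈ D.Rplus, D.k α * inner ℝ α v * diffQuot α f x =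
      ∑ i, v i * ∑ α ∈ D.Rplus, D.k α * α i * diffQuot α f x := by
    simp only [hinner, Finset.mul_sum, Finset.sum_mul]
    rw [Finset.sum_comm]
    exact Finset.sum_congr rfl fun i _ => Finset.sum_congr rfl fun α _ => by ring
  simp only [T, mul_add, Finset.sum_add_distrib]
  rw [hfderiv, hroots, add_sub_cancel_right]

theorem abs_sum_mul_T_le {D : RootData N} {f : E N → ℝ} {C : ℝ} (hC₀ : 0 ≤ C) {x : E N}
    (hC : ∑ i, T D i f x ^ 2 ≤ C ^ 2) (v : E N) : |∑ i, v i * T D i f x| ≤ C * ‖v‖ := by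
  refine abs_le_of_sq_le_sq ?_ (by positivity)
  calc (∑ i, v i * T D i f x) ^ 2 ≤ (∑ i, v i ^ 2) * ∑ i, T D i f x ^ 2 :=
        Finset.sum_mul_sq_le_sq_mul_sq _ _ _
    _ ≤ (∑ i, v i ^ 2) * C ^ 2 := by gcongr
    _ = (C * ‖v‖) ^ 2 := by
        rw [mul_pow, EuclideanSpace.real_norm_sq_eq v, mul_comm]

theorem abs_sum_inner_mul_diffQuot_le (D : RootData N) {f : E N → ℝ} {x : E N} {s : ℝ}
    (hs : ∀ α ∈ D.Rplus, |diffQuot α f x| ≤ s * ‖α‖) (v : E N) :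
    |∑ α ∈ D.Rplus, D.k α * inner ℝ α v * diffQuot α f x| ≤ 2 * D.gamma * s * ‖v‖ := by
  refine (Finset.abs_sum_le_sum_abs _ _).trans ?_
  rw [RootData.gamma, Finset.mul_sum, Finset.sum_mul, Finset.sum_mul]
  refine Finset.sum_le_sum fun α hα => ?_
  have hk := D.k_nonneg_of_mem hα
  calc |D.k α * inner ℝ α v * diffQuot α f x|
      = D.k α * |inner ℝ α v| * |diffQuot α f x| := by
        rw [abs_mul, abs_mul, abs_of_nonneg hk]
    _ ≤ D.k α * (‖α‖ * ‖v‖) * (s * ‖α‖) := by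
        gcongr
        · exact abs_real_inner_le_norm α v
        · exact hs α hα
    _ = D.k α * ‖α‖ ^ 2 * s * ‖v‖ := by ring
    _ = 2 * D.k α * s * ‖v‖ := by
        rw [D.norm_sq_of_mem hα]
        ring

theorem norm_fderiv_le {D : RootData N} (hγ : D.gamma < 1 / 2) {f : E N → ℝ}
    (hf : ContDiff ℝ 1 f) {C : ℝ} (hC₀ : 0 ≤ C) (hC : ∀ x, ∑ i, T D i f x ^ 2 ≤ C ^ 2) (x : E N) :
    ‖fderiv ℝ f x‖ ≤ C / (1 - 2 * D.gamma) := by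
  have hγ_nonneg : 0 ≤ D.gamma := Finset.sum_nonneg fun α hα => D.k_nonneg_of_mem hα
  -- At a maximum of `‖∇f‖` over a reflection invariant ball, the reflection terms of the Dunkl
  -- operators are at most `2γ` times that maximum, so they can be absorbed.
  obtain ⟨z, hz, hmax⟩ := (isCompact_closedBall (0 : E N) ‖x‖).exists_isMaxOn
    ⟨x, by simp⟩ (hf.continuous_fderiv one_ne_zero).norm.continuousOn
  have hquot : ∀ α ∈ D.Rplus, |diffQuot α f z| ≤ ‖fderiv ℝ f z‖ * ‖α‖ := fun α hα =>
    abs_diffQuot_le (D.norm_sq_of_mem hα) (hf.differentiable one_ne_zero) (fun y hy => hmax hy) hz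
  have hle : ‖fderiv ℝ f z‖ ≤ C + 2 * D.gamma * ‖fderiv ℝ f z‖ := by
    refine ContinuousLinearMap.opNorm_le_bound _ (by positivity) fun v => ?_
    rw [fderiv_apply_eq_sum_T D, add_mul]
    exact (abs_sub _ _).trans
      (add_le_add (abs_sum_mul_T_le hC₀ (hC z) v) (abs_sum_inner_mul_diffQuot_le D hquot v))
  have hxz : ‖fderiv ℝ f x‖ ≤ ‖fderiv ℝ f z‖ := hmax (by simp)
  refine hxz.trans ((le_div_iff₀ (by linarith)).2 ?_)
  linarith

theorem sum_T_sq_le_symGrad (D : RootData N) (f : E N → ℝ) (x : E N) :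
    ∑ i, T D i f x ^ 2 ≤ symGrad D f x :=
  Finset.single_le_sum (f := fun g : D.G => ∑ i, T D i f (g.1 x) ^ 2)
    (fun _ _ => Finset.sum_nonneg fun _ _ => sq_nonneg _) (Finset.mem_univ 1)

namespace MarkovSemigroup

variable {S : MarkovSemigroup N}

/-- Asymptotic flattening of test functions: `P_t f` is Lipschitz with a constant that tends to
zero as `t → ∞`. -/
def Flattens (S : MarkovSemigroup N) : Prop :=
  ∀ f : E N →ᵇ ℝ, IsTest f → ∃ C : ℝ≥0 → ℝ≥0, Tendsto C atTop (𝓝 0) ∧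
    ∀ t, 0 < t → LipschitzWith (C t) (S.P t f)

theorem GradientBound.sum_T_sq_le {D : RootData N} {η : ℝ} (hgrad : S.GradientBound D η)
    {f g : E N →ᵇ ℝ} (hf : IsTest f) (hg : ∀ x, g x = symGrad D f x) {t : ℝ≥0} (ht : 0 < t)
    (x : E N) : ∑ i, T D i (S.P t f) x ^ 2 ≤ (Real.exp (η * t) * √‖g‖) ^ 2 := by
  have hPg : S.P t g x ≤ ‖g‖ :=
    S.P_le_of_le t (fun y => (le_abs_self _).trans (g.norm_coe_le_norm y)) x
  calc ∑ i, T D i (S.P t f) x ^ 2 ≤ Real.exp (2 * η * t) * S.P t g x :=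
        (sum_T_sq_le_symGrad D _ x).trans ((hgrad f hf g hg t ht).2 x)
    _ ≤ Real.exp (2 * η * t) * ‖g‖ := by gcongr
    _ = (Real.exp (η * t) * √‖g‖) ^ 2 := by
        rw [mul_pow, Real.sq_sqrt (norm_nonneg _), ← Real.exp_nat_mul]
        push_cast
        ring_nf

theorem GradientBound.flattens {D : RootData N} {η : ℝ} (hgrad : S.GradientBound D η)
    (hγ : D.gamma < 1 / 2) (hη : η < 0) : S.Flattens := by
  intro f hf
  obtain ⟨g, hg⟩ := exists_bcf_symGrad D hf
  refine ⟨fun t => (Real.exp (η * t) * √‖g‖ / (1 - 2 * D.gamma)).toNNReal, ?_, fun t ht => ?_⟩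
  · have hexp : Tendsto (fun t : ℝ≥0 => Real.exp (η * t)) atTop (𝓝 0) :=
      Real.tendsto_exp_atBot.comp
        ((NNReal.tendsto_coe_atTop.2 tendsto_id).const_mul_atTop_of_neg hη)
    simpa using tendsto_real_toNNReal ((hexp.mul_const √‖g‖).div_const (1 - 2 * D.gamma))
  · have hC1 : ContDiff ℝ 1 (S.P t f) := (hgrad f hf g hg t ht).1
    refine lipschitzWith_of_nnnorm_fderiv_le (𝕜 := ℝ) (hC1.differentiable one_ne_zero) fun x =>
      NNReal.coe_le_coe.1 (le_trans ?_ (Real.le_coe_toNNReal _))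
    exact norm_fderiv_le hγ hC1 (by positivity) (hgrad.sum_T_sq_le hf hg ht) x

end MarkovSemigroup

/-! ### Long-time behaviour -/

open scoped CompactlySupported in
theorem exists_isTest_approx (f : E N →ᵇ ℝ) {K : Set (E N)} (hK : IsCompact K) {ε : ℝ}
    (hε : 0 < ε) :
    ∃ g : E N →ᵇ ℝ, IsTest g ∧ ‖f - g‖ ≤ ‖f‖ + ε ∧ ∀ y ∈ K, |(f - g) y| ≤ ε := by
  obtain ⟨χ, hχK, hχ⟩ := exists_compactlySupported_eq_one hK
  let χb := χ.toBoundedContinuousFunction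
  obtain ⟨g, hg_smooth, hg_dist, hg_supp⟩ := (f * χb).continuous.exists_contDiff_approx ⊤
    (ε := fun _ => ε) continuous_const fun _ => hε
  have hg_compact : HasCompactSupport g :=
    (χ.hasCompactSupport.mul_left (f := ⇑f)).mono hg_supp
  let gb := CompactlySupportedContinuousMap.toBoundedContinuousFunction
    (⟨⟨g, hg_smooth.continuous⟩, hg_compact⟩ : C_c(E N, ℝ))
  have hfχ_le (y : E N) : |(f * χb - gb) y| ≤ ε :=
    (abs_sub_comm ((f * χb) y) (g y)).trans_le (hg_dist y).le
  have hsplit : f - gb = f * (1 - χb) + (f * χb - gb) := by ring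
  refine ⟨gb, ⟨hg_smooth, hg_compact⟩, ?_, fun y hy => ?_⟩
  · rw [hsplit]
    exact (norm_add_le _ _).trans (add_le_add (norm_mul_one_sub_le f hχ)
      ((BoundedContinuousFunction.norm_le hε.le).2 hfχ_le))
  · have hχy : χb y = 1 := hχK y hy
    simpa [hχy] using hfχ_le y

theorem IsTightFamily.tendsto_zero_of_isTest {ι : Type*} {l : Filter ι}
    {Λ : ι → (E N →ᵇ ℝ) → ℝ} (hΛ : IsTightFamily Λ)
    (hsub : ∀ i f g, Λ i (f - g) = Λ i f - Λ i g)
    (htest : ∀ g, IsTest g → Tendsto (fun i => Λ i g) l (𝓝 0)) (f : E N →ᵇ ℝ) :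
    Tendsto (fun i => Λ i f) l (𝓝 0) := by
  refine Metric.tendsto_nhds.2 fun ε hε => ?_
  obtain ⟨K, hK, δ, hδ, hsmall⟩ := hΛ (‖f‖ + 1) (ε / 2) (half_pos hε)
  obtain ⟨g, hg, hg_norm, hgK⟩ := exists_isTest_approx f hK (lt_min hδ one_pos)
  have hfg (i : ι) : |Λ i (f - g)| ≤ ε / 2 :=
    hsmall _ (hg_norm.trans (by gcongr; exact min_le_right _ _))
      (fun y hy => (hgK y hy).trans (min_le_left _ _)) i
  filter_upwards [Metric.tendsto_nhds.1 (htest g hg) (ε / 2) (half_pos hε)] with i hi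
  rw [dist_zero_right] at hi ⊢
  calc ‖Λ i f‖ = |Λ i (f - g) + Λ i g| := by rw [hsub, sub_add_cancel, Real.norm_eq_abs]
    _ ≤ |Λ i (f - g)| + ‖Λ i g‖ := abs_add_le _ _
    _ < ε / 2 + ε / 2 := add_lt_add_of_le_of_lt (hfg i) hi
    _ = ε := add_halves ε

namespace MarkovSemigroup

variable {S : MarkovSemigroup N}

theorem Flattens.tendsto_P_sub_P (hfl : S.Flattens) {x y : E N} (hx : S.IsTightAt x)
    (hy : S.IsTightAt y) (f : E N →ᵇ ℝ) :
    Tendsto (fun t => S.P t f x - S.P t f y) atTop (𝓝 0) := by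
  refine (hx.sub hy).tendsto_zero_of_isTest (fun t f g => ?_) (fun g hg => ?_) f
  · simp only [map_sub, BoundedContinuousFunction.coe_sub, Pi.sub_apply]
    ring
  · obtain ⟨C, hC, hlip⟩ := hfl g hg
    have hC_mul : Tendsto (fun t => C t * dist x y) atTop (𝓝 0) := by
      simpa using (NNReal.tendsto_coe.2 hC).mul_const (dist x y)
    refine squeeze_zero_norm' ?_ hC_mul
    filter_upwards [eventually_gt_atTop 0] with t ht
    exact (hlip t ht).dist_le_mul x y

theorem Flattens.cauchySeq_of_isTest (hfl : S.Flattens) {x : E N} (hx : S.IsTightAt x)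
    {f : E N →ᵇ ℝ} (hf : IsTest f) : CauchySeq fun t => S.P t f x := by
  obtain ⟨C, hC, hlip⟩ := hfl f hf
  refine Metric.cauchySeq_iff'.2 fun ε hε => ?_
  obtain ⟨K, hK, δ, hδ, hsmall⟩ := hx (2 * ‖f‖) (ε / 2) (half_pos hε)
  obtain ⟨r, hKr⟩ := hK.isBounded.subset_closedBall x
  have hC_mul : Tendsto (fun t => C t * r) atTop (𝓝 0) := by
    simpa using (NNReal.tendsto_coe.2 hC).mul_const r
  obtain ⟨n, hn, hn_pos⟩ :=
    ((hC_mul.eventually_le_const hδ).and (eventually_gt_atTop 0)).exists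
  -- `P_{s+n} f - P_n f x = P_s w` for a function `w` that is small on the large compact set `K`.
  let w : E N →ᵇ ℝ := S.P n f - BoundedContinuousFunction.const (E N) (S.P n f x)
  have hw_norm : ‖w‖ ≤ 2 * ‖f‖ := by
    have hconst : ‖BoundedContinuousFunction.const (E N) (S.P n f x)‖ ≤ ‖S.P n f‖ :=
      (BoundedContinuousFunction.norm_const_le _).trans ((S.P n f).norm_coe_le_norm x)
    linarith [norm_sub_le (S.P n f) (BoundedContinuousFunction.const (E N) (S.P n f x)),
      S.norm_P_le n f]
  have hw_small : ∀ y ∈ K, |w y| ≤ δ := fun y hy =>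
    calc |w y| ≤ C n * dist y x := (hlip n hn_pos).dist_le_mul y x
      _ ≤ C n * r := by gcongr; exact hKr hy
      _ ≤ δ := hn
  refine ⟨n, fun t ht => ?_⟩
  obtain ⟨s, rfl⟩ : ∃ s, t = s + n := ⟨t - n, (tsub_add_cancel_of_le ht).symm⟩
  have hPw : S.P s w x = S.P (s + n) f x - S.P n f x := by
    simp [w, S.add, S.P_const]
  calc dist (S.P (s + n) f x) (S.P n f x) = |S.P s w x| := by rw [hPw, Real.dist_eq]
    _ ≤ ε / 2 := hsmall w hw_norm hw_small s
    _ < ε := half_lt_self hε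

theorem Flattens.cauchySeq (hfl : S.Flattens) {x : E N} (hx : S.IsTightAt x) (f : E N →ᵇ ℝ) :
    CauchySeq fun t => S.P t f x := by
  have hzero : Tendsto (fun p : ℝ≥0 × ℝ≥0 => S.P p.1 f x - S.P p.2 f x) atTop (𝓝 0) := by
    refine ((hx.comp Prod.fst).sub (hx.comp Prod.snd)).tendsto_zero_of_isTest
      (fun p f g => ?_) (fun g hg => ?_) f
    · simp only [map_sub, BoundedContinuousFunction.coe_sub, Pi.sub_apply]
      ring
    · exact tendsto_zero_iff_norm_tendsto_zero.2
        (cauchySeq_iff_tendsto_dist_atTop_0.1 (hfl.cauchySeq_of_isTest hx hg))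
  exact cauchySeq_iff_tendsto_dist_atTop_0.2 (tendsto_zero_iff_norm_tendsto_zero.1 hzero)

theorem Flattens.exists_positiveLinearMap (hfl : S.Flattens) {x : E N} (hx : S.IsTightAt x) :
    ∃ Λ : (E N →ᵇ ℝ) →ₚ[ℝ] ℝ, ∀ f, Tendsto (fun t => S.P t f x) atTop (𝓝 (Λ f)) := by
  choose Λ hΛ using fun f => cauchySeq_tendsto_of_complete (hfl.cauchySeq hx f)
  let evalP (t : ℝ≥0) : (E N →ᵇ ℝ) →ₗ[ℝ] ℝ :=
    (BoundedContinuousFunction.evalCLM ℝ x).toLinearMap ∘ₗ S.P t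
  exact ⟨PositiveLinearMap.mk₀ (linearMapOfTendsto Λ evalP (tendsto_pi_nhds.2 hΛ))
    fun f hf => ge_of_tendsto' (hΛ f) fun t => S.nonneg t f hf x, hΛ⟩

theorem Flattens.exists_tendsto_integral (hfl : S.Flattens) {x₀ : E N} (hx₀ : S.IsTightAt x₀) :
    ∃ ν : Measure (E N), IsProbabilityMeasure ν ∧ ∀ (f : E N →ᵇ ℝ) (x : E N), S.IsTightAt x →
      Tendsto (fun t => S.P t f x) atTop (𝓝 (∫ y, f y ∂ν)) := by
  obtain ⟨Λ, hΛ⟩ := hfl.exists_positiveLinearMap hx₀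
  have hone : Λ 1 = 1 := by
    refine tendsto_nhds_unique (hΛ 1) (tendsto_const_nhds.congr fun t => ?_)
    exact (DFunLike.congr_fun (S.one t) x₀).symm
  obtain ⟨ν, hν, hΛν⟩ := (hx₀.of_tendsto hΛ).exists_isProbabilityMeasure hone
  refine ⟨ν, hν, fun f x hx => ?_⟩
  have hadd := (hfl.tendsto_P_sub_P hx hx₀ f).add (hΛ f)
  simpa only [sub_add_cancel, zero_add, hΛν] using hadd

theorem isInvariant_of_tendsto {ν : Measure (E N)} {x : E N}
    (h : ∀ f : E N →ᵇ ℝ, Tendsto (fun t => S.P t f x) atTop (𝓝 (∫ y, f y ∂ν))) :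
    S.IsInvariant ν := by
  intro t f
  have hshift : Tendsto (fun s => S.P (s + t) f x) atTop (𝓝 (∫ y, f y ∂ν)) :=
    (h f).comp (tendsto_atTop_mono (fun _ => le_self_add) tendsto_id)
  simp only [S.add] at hshift
  exact tendsto_nhds_unique (h (S.P t f)) hshift

end MarkovSemigroup

end Dunkl

end

theorem theorem3p2_general {N : ℕ} (D : Dunkl.RootData N) (b : Dunkl.E N → Dunkl.E N)
    (S : Dunkl.MarkovSemigroup N) (hS : S.IsGeneratedBy D b)
    (hγ : D.gamma < 1 / 2) (η : ℝ) (hη : η < 0) (hgrad : S.GradientBound D η)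
    (ρ : Dunkl.E N → ℝ≥0∞) (hρ : Dunkl.IsLyapunov D b ρ) :
    ∃ ν : Measure (Dunkl.E N), IsProbabilityMeasure ν ∧
      (∀ (f : Dunkl.E N →ᵇ ℝ) (x : Dunkl.E N), ρ x ≠ ⊤ →
        Tendsto (fun t => S.P t f x) atTop (𝓝 (∫ y, f y ∂ν))) ∧
      S.IsInvariant ν := by
  obtain ⟨x₀, hx₀⟩ := hρ.exists_ne_top
  obtain ⟨ν, hν, hconv⟩ := (hgrad.flattens hγ hη).exists_tendsto_integral (hρ.isTightAt hS hx₀)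
  exact ⟨ν, hν, fun f x hx => hconv f x (hρ.isTightAt hS hx),
    S.isInvariant_of_tendsto fun f => hconv f x₀ (hρ.isTightAt hS hx₀)⟩

theorem theorem3p2 {N : ℕ} (D : Dunkl.RootData N) (b : Dunkl.E N → Dunkl.E N)
    (hb : ContDiff ℝ 1 b) (S : Dunkl.MarkovSemigroup N) (hS : S.IsGeneratedBy D b)
    (hγ : D.gamma < 1 / 2) (η : ℝ) (hη : η < 0) (hgrad : S.GradientBound D η)
    (ρ : Dunkl.E N → ℝ≥0∞) (hρ : Dunkl.IsLyapunov D b ρ) :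
    ∃ (t : ℕ → ℝ≥0) (ν : Measure (Dunkl.E N)), Tendsto t atTop atTop ∧
      IsProbabilityMeasure ν ∧
      (∀ (f : Dunkl.E N →ᵇ ℝ) (x : Dunkl.E N), ρ x ≠ ⊤ →
        Tendsto (fun l => S.P (t l) f x) atTop (𝓝 (∫ y, f y ∂ν))) ∧
      S.IsInvariant ν := by
  obtain ⟨ν, hν, hconv, hinv⟩ := theorem3p2_general D b S hS hγ η hη hgrad ρ hρ
  exact ⟨fun l => l, ν, tendsto_natCast_atTop_atTop, hν,
    fun f x hx => (hconv f x hx).comp tendsto_natCast_atTop_atTop, hinv⟩
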